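/- **Closed-form outage probabilities and accuracy indices for a Poisson field of interferers with Rayleigh fading.** *Model.* Let $p,c,\alpha,a,\lambda,\beta>0$, $\sigma\ge 0$, $d_0\ge a$, $r_{\mathrm{IBM}}\ge a$, $r_{\mathrm{PRM}}\ge a$. A receiver sits at the origin of the plane, its intended transmitter is at distance $d_0$, and the interferers are the points $X_k$ of a homogeneous Poisson point process on $\mathbb R^2$ with intensity $\lambda$; put $d_k=\|X_k\|$. The fading gains $h_0$ (intended link) and $h_k$ (interferers) are i.i.d. with density $e^{-x}$, $x>0$, and are independent of the point process. The channel gain of transmitter $i$ is $g_i=c\,h_i\,\ell(d_i)$, where $\ell(d)=d^{-\alpha}$ for $d\ge a$ and $\ell(d)=1$ for $d<a$. Define, with values in $[0,\infty]$, $$\gamma^{\mathrm{PhyM}}=\frac{p g_0}{\sum_k p g_k+\sigma},\qquad \gamma^{\mathrm{IBM}}=\frac{p g_0}{\sum_{k:\,d_k\le r_{\mathrm{IBM}}} p g_k+\sigma},$$ and let $\gamma^{\mathrm{PRM}}=0$ if some $d_k\le r_{\mathrm{PRM}}$ and $\gamma^{\mathrm{PRM}}=\infty$ otherwise (equivalently,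 almost surely, $\gamma^{\mathrm{PRM}}=p g_0/\sum_k p\,a_kg_k$ with $a_k=\infty$ if $d_k\le r_{\mathrm{PRM}}$ and $a_k=0$ otherwise); thus outage $\gamma^{\mathrm{PRM}}<\beta$ under the protocol model means that some interferer is within distance $r_{\mathrm{PRM}}$. For models $\mathrm x,\mathrm y$ put $p_{\mathrm{fa}}^{\mathrm x|\mathrm y}=\Pr[\gamma^{\mathrm x}<\beta\mid\gamma^{\mathrm y}\ge\beta]$, $p_{\mathrm{md}}^{\mathrm x|\mathrm y}=\Pr[\gamma^{\mathrm x}\ge\beta\mid\gamma^{\mathrm y}<\beta]$ and, for $\xi\in[0,1]$, $S_{\beta,\xi}(\mathrm x\|\mathrm y)=\xi(1-p_{\mathrm{fa}}^{\mathrm x|\mathrm y})+(1-\xi)(1-p_{\mathrm{md}}^{\mathrm x|\mathrm y})$. Let $\Gamma(s,x)=\int_x^\infty t^{s-1}e^{-t}\,dt$, let $\mathbf E_h$ be expectation over $h$ with density $e^{-x}$, $x>0$, and abbreviate $s_h=\beta d_0^\alpha h$. *Claim.* (The variables under each $\mathbf E_h$ below are integrable.) 1. $\Pr[\gamma^{\mathrm{IBM}}<\beta]=P_{\mathrm{IBM}}$,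 where $$P_{\mathrm{IBM}}=1-\exp\Big\{-\tfrac{\sigma\beta d_0^\alpha}{pc}-\pi\lambda\,\mathbf E_h\Big[a^2(1-e^{-s_h})+r_{\mathrm{IBM}}^2(1-e^{-s_hr_{\mathrm{IBM}}^{-\alpha}})-a^2(1-e^{-s_ha^{-\alpha}})+s_h^{2/\alpha}\Gamma(1-\tfrac2\alpha,s_hr_{\mathrm{IBM}}^{-\alpha})-s_h^{2/\alpha}\Gamma(1-\tfrac2\alpha,s_ha^{-\alpha})\Big]\Big\}.$$ 2. $\Pr[\gamma^{\mathrm{PRM}}<\beta]=P_{\mathrm{PRM}}$, where $P_{\mathrm{PRM}}=1-e^{-\lambda\pi r_{\mathrm{PRM}}^2}$. If moreover $\alpha>2$, then: 3. $\Pr[\gamma^{\mathrm{PhyM}}<\beta]=P_{\mathrm{PhyM}}\in(0,1)$, where $$P_{\mathrm{PhyM}}=1-\exp\Big\{-\tfrac{\sigma\beta d_0^\alpha}{pc}-\pi\lambda\,\mathbf E_h\Big[a^2(1-e^{-s_h})-a^2(1-e^{-s_ha^{-\alpha}})+s_h^{2/\alpha}\Gamma(1-\tfrac2\alpha)-s_h^{2/\alpha}\Gamma(1-\tfrac2\alpha,s_ha^{-\alpha})\Big]\Big\}.$$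 4. $\Pr[\gamma^{\mathrm{PhyM}}<\beta\mid\gamma^{\mathrm{PRM}}\ge\beta]=Q$, where $$Q=1-\exp\Big\{-\tfrac{\sigma\beta d_0^\alpha}{pc}-\pi\lambda\,\mathbf E_h\Big[-r_{\mathrm{PRM}}^2(1-e^{-s_hr_{\mathrm{PRM}}^{-\alpha}})+s_h^{2/\alpha}\Gamma(1-\tfrac2\alpha)-s_h^{2/\alpha}\Gamma(1-\tfrac2\alpha,s_hr_{\mathrm{PRM}}^{-\alpha})\Big]\Big\}.$$ 5. $p_{\mathrm{fa}}^{\mathrm{IBM}|\mathrm{PhyM}}=0$ and $p_{\mathrm{md}}^{\mathrm{IBM}|\mathrm{PhyM}}=1-P_{\mathrm{IBM}}/P_{\mathrm{PhyM}}$. Hence $S_{\beta,\xi}(\mathrm{IBM}\|\mathrm{PhyM})=1-(1-\xi)(1-P_{\mathrm{IBM}}/P_{\mathrm{PhyM}})$ for every $\xi\in[0,1]$, and for $\xi=\Pr[\gamma^{\mathrm{PhyM}}\ge\beta]$ this equals $1-(P_{\mathrm{PhyM}}-P_{\mathrm{IBM}})$. 6. $p_{\mathrm{fa}}^{\mathrm{PRM}|\mathrm{PhyM}}=1-\frac{(1-P_{\mathrm{PRM}})(1-Q)}{1-P_{\mathrm{PhyM}}}$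 and $p_{\mathrm{md}}^{\mathrm{PRM}|\mathrm{PhyM}}=\frac{(1-P_{\mathrm{PRM}})Q}{P_{\mathrm{PhyM}}}$. Hence $S_{\beta,\xi}(\mathrm{PRM}\|\mathrm{PhyM})=1-\xi\,p_{\mathrm{fa}}^{\mathrm{PRM}|\mathrm{PhyM}}-(1-\xi)\,p_{\mathrm{md}}^{\mathrm{PRM}|\mathrm{PhyM}}$ with these values for every $\xi\in[0,1]$, and for $\xi=\Pr[\gamma^{\mathrm{PhyM}}\ge\beta]$ this equals $P_{\mathrm{PhyM}}+(1-P_{\mathrm{PRM}})(1-2Q)$. -/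

import Mathlib

open MeasureTheory ProbabilityTheory Set
open scoped ENNReal NNReal

noncomputable section

namespace OutageModel

/-- The plane with its Euclidean norm and Lebesgue measure; the typical receiver sits at `0`. -/
abbrev Plane : Type := EuclideanSpace ℝ (Fin 2)

/-- Number of points of the configuration `x` that lie in `B`, counted with multiplicity. -/
def pointCount {E : Type*} (x : ℕ → E) (B : Set E) : ℕ∞ :=
  Set.encard {k : ℕ | x k ∈ B}

/-- The (measurably enumerated) random points `X 0, X 1, …` form a Poisson point process with
intensity measure `Λ`: Poisson counts on sets of finite intensity, independent counts on
disjoint sets. -/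
structure IsPoissonProcess {Ω E : Type*} [MeasurableSpace Ω] [MeasurableSpace E]
    (P : Measure Ω) (X : ℕ → Ω → E) (Λ : Measure E) : Prop where
  measurable : ∀ k, Measurable (X k)
  count_law : ∀ B : Set E, MeasurableSet B → Λ B ≠ ∞ → ∀ n : ℕ,
    P {ω | pointCount (fun k => X k ω) B = (n : ℕ∞)} = poissonMeasure (Λ B).toNNReal {n}
  count_indep : ∀ (m : ℕ) (B : Fin m → Set E), (∀ i, MeasurableSet (B i)) →
    Pairwise (Function.onFun Disjoint B) →
    iIndepFun (fun (i : Fin m) (ω : Ω) => pointCount (fun k => X k ω) (B i)) P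

/-- Homogeneous planar Poisson field of interferers of intensity `lam`, at positions `X k`, with
Rayleigh fading: the power gains `h₀` (intended link) and `h k` (interferer `k`) are i.i.d. with
density `exp (-x)` on `x > 0`, and are independent of the positions. -/
structure IsRayleighPoissonNetwork {Ω : Type*} [MeasurableSpace Ω] (P : Measure Ω)
    (lam : ℝ) (X : ℕ → Ω → Plane) (h₀ : Ω → ℝ) (h : ℕ → Ω → ℝ) : Prop where
  poisson : IsPoissonProcess P X (ENNReal.ofReal lam • (volume : Measure Plane))
  measurable_h₀ : Measurable h₀
  measurable_h : ∀ k, Measurable (h k)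
  law_h₀ : P.map h₀ = expMeasure 1
  law_h : ∀ k, P.map (h k) = expMeasure 1
  indep_h : iIndepFun h P
  indep_X_h : IndepFun (fun (ω : Ω) (k : ℕ) => X k ω) (fun (ω : Ω) (k : ℕ) => h k ω) P
  indep_h₀ : IndepFun h₀ (fun ω : Ω => ((fun k : ℕ => X k ω), (fun k : ℕ => h k ω))) P

/-- Deterministic parameters: transmission power `p`, attenuation `c` at unit distance, path-loss
exponent `α`, radius `a` of the disk without path loss, noise power `σ`, length `d₀` of the
intended link. -/
structure Params where
  (p c α a σ d₀ : ℝ)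

/-- Modified power law: `d ^ (-α)` outside the open disk of radius `a`, no attenuation inside. -/
def pathLoss (α a d : ℝ) : ℝ := if a ≤ d then d ^ (-α) else 1

/-- Channel gain `c h d ^ (-α 1_{d ≥ a})`. -/
def channelGain (q : Params) (h d : ℝ) : ℝ := q.c * h * pathLoss q.α q.a d

/-- SINR at the typical receiver when the channel gain of interferer `k` is multiplied by the
weight `w k ∈ [0, ∞]` and the noise power is `noise`. Values are in `[0, ∞]`. -/
def sinr (q : Params) (noise : ℝ) (w : ℕ → ℝ≥0∞) (x : ℕ → Plane) (h₀ : ℝ) (h : ℕ → ℝ) : ℝ≥0∞ :=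
  ENNReal.ofReal (q.p * channelGain q h₀ q.d₀) /
    ((∑' k, ENNReal.ofReal q.p * (w k * ENNReal.ofReal (channelGain q (h k) ‖x k‖)))
      + ENNReal.ofReal noise)

/-- Physical model: every interferer counts. -/
def sinrPhyM {Ω : Type*} (q : Params) (X : ℕ → Ω → Plane) (h₀ : Ω → ℝ) (h : ℕ → Ω → ℝ)
    (ω : Ω) : ℝ≥0∞ :=
  sinr q q.σ (fun _ => 1) (fun k => X k ω) (h₀ ω) (fun k => h k ω)

/-- Interference ball model: only interferers at distance at most `r` count. -/
def sinrIBM {Ω : Type*} (q : Params) (r : ℝ) (X : ℕ → Ω → Plane) (h₀ : Ω → ℝ) (h : ℕ → Ω → ℝ)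
    (ω : Ω) : ℝ≥0∞ :=
  sinr q q.σ (fun k => if ‖X k ω‖ ≤ r then 1 else 0) (fun k => X k ω) (h₀ ω) (fun k => h k ω)

/-- Protocol model: interferers at distance at most `r` have infinite virtual gain, all others
gain zero. Outage in this model is decided by the presence of an interferer in range alone, so
noise does not enter: the value is (almost surely) `0` if some interferer is within distance `r`
and `∞` otherwise. -/
def sinrPRM {Ω : Type*} (q : Params) (r : ℝ) (X : ℕ → Ω → Plane) (h₀ : Ω → ℝ) (h : ℕ → Ω → ℝ)
    (ω : Ω) : ℝ≥0∞ :=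
  sinr q 0 (fun k => if ‖X k ω‖ ≤ r then ∞ else 0) (fun k => X k ω) (h₀ ω) (fun k => h k ω)

/-- The event `γ < β`. -/
def outage {Ω : Type*} (γ : Ω → ℝ≥0∞) (β : ℝ) : Set Ω := {ω | γ ω < ENNReal.ofReal β}

/-- The event `γ ≥ β`. -/
def noOutage {Ω : Type*} (γ : Ω → ℝ≥0∞) (β : ℝ) : Set Ω := {ω | ENNReal.ofReal β ≤ γ ω}

/-- False alarm probability `Pr[γx < β | γy ≥ β]` of test model `γx` for reference `γy`. -/
def falseAlarm {Ω : Type*} [MeasurableSpace Ω] (P : Measure Ω) (β : ℝ) (γx γy : Ω → ℝ≥0∞) : ℝ :=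
  (cond P (noOutage γy β)).real (outage γx β)

/-- Miss-detection probability `Pr[γx ≥ β | γy < β]`. -/
def missDetection {Ω : Type*} [MeasurableSpace Ω] (P : Measure Ω) (β : ℝ)
    (γx γy : Ω → ℝ≥0∞) : ℝ :=
  (cond P (outage γy β)).real (noOutage γx β)

/-- Similarity (accuracy) index `S_{β,ξ}(γx ‖ γy)`. -/
def similarityIndex {Ω : Type*} [MeasurableSpace Ω] (P : Measure Ω) (β ξ : ℝ)
    (γx γy : Ω → ℝ≥0∞) : ℝ :=
  ξ * (1 - falseAlarm P β γx γy) + (1 - ξ) * (1 - missDetection P β γx γy)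

/-- Upper incomplete Gamma function `Γ(s, x) = ∫_x^∞ t^(s-1) e^(-t) dt`. -/
def upperGamma (s x : ℝ) : ℝ := ∫ t in Ioi x, t ^ (s - 1) * Real.exp (-t)

/-- Quantity averaged over `h` in the closed form for the interference ball model. -/
def ibmTerm (q : Params) (β r h : ℝ) : ℝ :=
  q.a ^ 2 * (1 - Real.exp (-(β * q.d₀ ^ q.α * h)))
    + r ^ 2 * (1 - Real.exp (-(β * q.d₀ ^ q.α * h * r ^ (-q.α))))
    - q.a ^ 2 * (1 - Real.exp (-(β * q.d₀ ^ q.α * h * q.a ^ (-q.α))))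
    + (β * q.d₀ ^ q.α * h) ^ (2 / q.α)
        * upperGamma (1 - 2 / q.α) (β * q.d₀ ^ q.α * h * r ^ (-q.α))
    - (β * q.d₀ ^ q.α * h) ^ (2 / q.α)
        * upperGamma (1 - 2 / q.α) (β * q.d₀ ^ q.α * h * q.a ^ (-q.α))

/-- Quantity averaged over `h` in the closed form for the physical model. -/
def phyTerm (q : Params) (β h : ℝ) : ℝ :=
  q.a ^ 2 * (1 - Real.exp (-(β * q.d₀ ^ q.α * h)))
    - q.a ^ 2 * (1 - Real.exp (-(β * q.d₀ ^ q.α * h * q.a ^ (-q.α))))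
    + (β * q.d₀ ^ q.α * h) ^ (2 / q.α) * Real.Gamma (1 - 2 / q.α)
    - (β * q.d₀ ^ q.α * h) ^ (2 / q.α)
        * upperGamma (1 - 2 / q.α) (β * q.d₀ ^ q.α * h * q.a ^ (-q.α))

/-- Quantity averaged over `h` in the closed form conditioned on no protocol-model outage. -/
def prmTerm (q : Params) (β r h : ℝ) : ℝ :=
  -(r ^ 2 * (1 - Real.exp (-(β * q.d₀ ^ q.α * h * r ^ (-q.α)))))
    + (β * q.d₀ ^ q.α * h) ^ (2 / q.α) * Real.Gamma (1 - 2 / q.α)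
    - (β * q.d₀ ^ q.α * h) ^ (2 / q.α)
        * upperGamma (1 - 2 / q.α) (β * q.d₀ ^ q.α * h * r ^ (-q.α))

/-- `1 - exp (-σ β d₀^α / (p c) - π lam E_h[F h])` with `h` exponential of mean `1`. -/
def closedForm (q : Params) (lam β : ℝ) (F : ℝ → ℝ) : ℝ :=
  1 - Real.exp (-(q.σ * β * q.d₀ ^ q.α) / (q.p * q.c)
    - Real.pi * lam * ∫ x, F x ∂(expMeasure 1))

/-- Closed form of `Pr[γ^IBM < β]`. -/
def ibmOutage (q : Params) (lam β r : ℝ) : ℝ := closedForm q lam β (ibmTerm q β r)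

/-- Closed form of `Pr[γ^PhyM < β]`. -/
def phyOutage (q : Params) (lam β : ℝ) : ℝ := closedForm q lam β (phyTerm q β)

/-- Closed form of `Pr[γ^PRM < β]`. -/
def prmOutage (lam r : ℝ) : ℝ := 1 - Real.exp (-(lam * Real.pi * r ^ 2))

/-- Closed form of `Pr[γ^PhyM < β | γ^PRM ≥ β]`. -/
def phyOutageGivenPRM (q : Params) (lam β r : ℝ) : ℝ := closedForm q lam β (prmTerm q β r)

end OutageModel

end

/-!
Dividing by the received power of the intended link, `γ ≥ β` becomes `N + I ≤ h₀`, where `N` is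
deterministic and `I = ∑ k, h k * g (X k)` with a gain function `g`. As `h₀` is exponential and
independent of everything else, this event has probability `exp (-N) * E[exp (-I)]`, and the
expectation is the Laplace functional of the marked Poisson process,
`exp (-lam * E_h[∫ (1 - exp (-h * g y)) dy])`. In polar coordinates the inner integral is
elementary up to upper incomplete Gamma functions, through integration by parts. In the interference
ball model `g` is cut off to `0` outside the ball. Requiring in addition that there is no outage
under the protocol model amounts to raising `g` to `∞` inside its ball, which gives the joint
probability of the two models and hence the conditional one.
-/

namespace OutageModel

open Filter Topology

/-! ### The decreasing exponential on `[0, ∞]` -/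

/-- `t ↦ exp (-t)` on `[0, ∞]`, with value `0` at `∞`. Sums in `[0, ∞]` always exist, so Laplace
functionals written with it need no summability hypotheses. -/
noncomputable def expNeg (t : ℝ≥0∞) : ℝ≥0∞ := EReal.exp (-(t : EReal))

@[simp] lemma expNeg_zero : expNeg 0 = 1 := by simp [expNeg]

@[simp] lemma expNeg_top : expNeg ∞ = 0 := by simp [expNeg]

lemma expNeg_add (s t : ℝ≥0∞) : expNeg (s + t) = expNeg s * expNeg t := by
  unfold expNeg
  rw [EReal.coe_ennreal_add, EReal.neg_add (by simp) (by simp), sub_eq_add_neg, EReal.exp_add]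

lemma expNeg_sum {ι : Type*} (s : Finset ι) (f : ι → ℝ≥0∞) :
    expNeg (∑ i ∈ s, f i) = ∏ i ∈ s, expNeg (f i) := by
  classical
  induction s using Finset.induction_on with
  | empty => simp
  | insert i s hi ih => rw [Finset.sum_insert hi, Finset.prod_insert hi, expNeg_add, ih]

lemma expNeg_mul_natCast (c : ℝ≥0∞) (n : ℕ) : expNeg (c * n) = expNeg c ^ n := by
  simpa [mul_comm] using expNeg_sum (Finset.range n) fun _ => c

lemma expNeg_antitone : Antitone expNeg := fun _ _ h =>
  EReal.exp_monotone (EReal.neg_le_neg_iff.2 (EReal.coe_ennreal_le_coe_ennreal_iff.2 h))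

lemma expNeg_le_one (t : ℝ≥0∞) : expNeg t ≤ 1 := by
  simpa using expNeg_antitone (zero_le (a := t))

lemma expNeg_ne_top (t : ℝ≥0∞) : expNeg t ≠ ∞ :=
  ne_top_of_le_ne_top ENNReal.one_ne_top (expNeg_le_one t)

lemma continuous_expNeg : Continuous expNeg :=
  ENNReal.continuous_exp.comp (continuous_neg.comp continuous_coe_ennreal_ereal)

@[fun_prop]
lemma measurable_expNeg : Measurable expNeg := continuous_expNeg.measurable

lemma expNeg_ofReal {x : ℝ} (hx : 0 ≤ x) :
    expNeg (ENNReal.ofReal x) = ENNReal.ofReal (Real.exp (-x)) := by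
  unfold expNeg
  rw [EReal.coe_ennreal_ofReal, max_eq_left hx, ← EReal.coe_neg, EReal.exp_coe]

lemma one_sub_expNeg_ofReal {x : ℝ} (hx : 0 ≤ x) :
    1 - expNeg (ENNReal.ofReal x) = ENNReal.ofReal (1 - Real.exp (-x)) := by
  rw [expNeg_ofReal hx, ENNReal.ofReal_sub _ (Real.exp_pos _).le, ENNReal.ofReal_one]

/-- The inverse of `expNeg` on `[0, 1]`: it turns products of numbers in `[0, 1]` into sums. -/
noncomputable def negLog (v : ℝ≥0∞) : ℝ≥0∞ := (-(ENNReal.log v)).toENNReal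

@[fun_prop]
lemma measurable_negLog : Measurable negLog :=
  (continuous_neg.comp ENNReal.continuous_log).measurable.ereal_toENNReal

lemma expNeg_negLog {v : ℝ≥0∞} (hv : v ≤ 1) : expNeg (negLog v) = v := by
  unfold expNeg negLog
  rw [EReal.coe_toENNReal (by simpa using hv), neg_neg, ENNReal.exp_log]

section Expectation

variable {Ω : Type*} [MeasurableSpace Ω] {P : Measure Ω}

lemma lintegral_expNeg_le_one [IsProbabilityMeasure P] (V : Ω → ℝ≥0∞) :
    ∫⁻ ω, expNeg (V ω) ∂P ≤ 1 :=
  (lintegral_mono fun _ => expNeg_le_one _).trans_eq (by simp)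

lemma lintegral_one_sub_expNeg [IsProbabilityMeasure P] {V : Ω → ℝ≥0∞} (hV : Measurable V) :
    ∫⁻ ω, (1 - expNeg (V ω)) ∂P = 1 - ∫⁻ ω, expNeg (V ω) ∂P := by
  rw [lintegral_sub (by fun_prop)
    (ne_top_of_le_ne_top ENNReal.one_ne_top (lintegral_expNeg_le_one V))
    (.of_forall fun ω => expNeg_le_one _), lintegral_one, measure_univ]

lemma tendsto_lintegral_expNeg [IsFiniteMeasure P] {V : ℕ → Ω → ℝ≥0∞} {W : Ω → ℝ≥0∞}
    (hV : ∀ n, Measurable (V n)) (hlim : ∀ ω, Tendsto (fun n => V n ω) atTop (𝓝 (W ω))) :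
    Tendsto (fun n => ∫⁻ ω, expNeg (V n ω) ∂P) atTop (𝓝 (∫⁻ ω, expNeg (W ω) ∂P)) :=
  tendsto_lintegral_of_dominated_convergence (fun _ => 1)
    (fun n => measurable_expNeg.comp (hV n)) (fun _ => .of_forall fun _ => expNeg_le_one _)
    (by simp) (.of_forall fun ω => (continuous_expNeg.tendsto _).comp (hlim ω))

lemma lintegral_expNeg_sum_of_iIndepFun {ι : Type*} {V : ι → Ω → ℝ≥0∞}
    (hV : ∀ i, Measurable (V i)) (hind : iIndepFun V P) (s : Finset ι) :
    ∫⁻ ω, expNeg (∑ i ∈ s, V i ω) ∂P = ∏ i ∈ s, ∫⁻ ω, expNeg (V i ω) ∂P := by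
  simp_rw [expNeg_sum]
  exact lintegral_prod_eq_prod_lintegral_of_indepFun s (fun i ω => expNeg (V i ω))
    (hind.comp _ fun _ => measurable_expNeg) fun i => measurable_expNeg.comp (hV i)

lemma lintegral_expNeg_tsum_of_iIndepFun {V : ℕ → Ω → ℝ≥0∞}
    (hV : ∀ k, Measurable (V k)) (hind : iIndepFun V P) :
    ∫⁻ ω, expNeg (∑' k, V k ω) ∂P = expNeg (∑' k, negLog (∫⁻ ω, expNeg (V k ω) ∂P)) := by
  have := hind.isProbabilityMeasure
  have hfin : ∀ n, ∫⁻ ω, expNeg (∑ k ∈ Finset.range n, V k ω) ∂P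
      = expNeg (∑ k ∈ Finset.range n, negLog (∫⁻ ω, expNeg (V k ω) ∂P)) := fun n => by
    simp_rw [lintegral_expNeg_sum_of_iIndepFun hV hind, expNeg_sum,
      expNeg_negLog (lintegral_expNeg_le_one _)]
  have hleft := tendsto_lintegral_expNeg (P := P)
    (fun n => Finset.measurable_fun_sum (Finset.range n) fun k _ => hV k)
    fun ω => ENNReal.tendsto_nat_tsum fun k => V k ω
  simp_rw [hfin] at hleft
  exact tendsto_nhds_unique hleft
    ((continuous_expNeg.tendsto _).comp (ENNReal.tendsto_nat_tsum _))

lemma lintegral_expNeg_tsum_comp_of_iIndepFun {M : Type*} [MeasurableSpace M] {ν : Measure M}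
    {h : ℕ → Ω → M} (hm : ∀ k, Measurable (h k)) (hlaw : ∀ k, P.map (h k) = ν)
    (hind : iIndepFun h P) {φ : ℕ → M → ℝ≥0∞} (hφ : ∀ k, Measurable (φ k)) :
    ∫⁻ ω, expNeg (∑' k, φ k (h k ω)) ∂P
      = expNeg (∑' k, negLog (∫⁻ u, expNeg (φ k u) ∂ν)) := by
  refine (lintegral_expNeg_tsum_of_iIndepFun (fun k => (hφ k).comp (hm k))
    (hind.comp φ hφ)).trans ?_
  congr! 3 with k
  rw [← hlaw k]
  exact congrArg negLog (lintegral_map (measurable_expNeg.comp (hφ k)) (hm k)).symm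

end Expectation

/-! ### Laplace functionals of Poisson processes -/

lemma lintegral_pow_poissonMeasure (r : ℝ≥0) {v : ℝ≥0∞} (hv : v ≤ 1) :
    ∫⁻ n, v ^ n ∂(poissonMeasure r) = expNeg (r * (1 - v)) := by
  lift v to ℝ≥0 using ne_top_of_le_ne_top ENNReal.one_ne_top hv
  have hv' : (v : ℝ) ≤ 1 := by exact_mod_cast hv
  have hsum : HasSum (fun n : ℕ => (v : ℝ) ^ n * (Real.exp (-r) * r ^ n / n.factorial))
      (Real.exp (-(r * (1 - v)))) := by
    have h := (NormedSpace.expSeries_div_hasSum_exp ((r : ℝ) * v)).mul_left (Real.exp (-r))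
    rw [← Real.exp_eq_exp_ℝ, ← Real.exp_add] at h
    convert! h using 1
    · ext n
      rw [mul_pow]
      ring
    · ring_nf
  have hexp : ((r : ℝ≥0∞) * (1 - v)) = ENNReal.ofReal (r * (1 - v)) := by
    rw [ENNReal.ofReal_mul (by positivity), ENNReal.ofReal_sub _ (by positivity)]
    simp
  rw [lintegral_countable', hexp, expNeg_ofReal (mul_nonneg r.coe_nonneg (by linarith)),
    ← hsum.tsum_eq, ENNReal.ofReal_tsum_of_nonneg (fun n => by positivity) hsum.summable]
  refine tsum_congr fun n => ?_
  rw [poissonMeasure_singleton, ENNReal.ofReal_mul (by positivity),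
    ENNReal.ofReal_pow (by positivity)]
  simp

lemma measure_eq_of_forall_natCast {μ ν : Measure ℕ∞} [IsProbabilityMeasure μ]
    [IsProbabilityMeasure ν] (h : ∀ n : ℕ, μ {(n : ℕ∞)} = ν {(n : ℕ∞)}) : μ = ν := by
  have htop : ({⊤} : Set ℕ∞) = (⋃ n : ℕ, {(n : ℕ∞)})ᶜ := by
    ext m
    induction m using ENat.recTopCoe <;> simp
  have hdisj : Pairwise (Function.onFun Disjoint fun n : ℕ => ({(n : ℕ∞)} : Set ℕ∞)) :=
    fun m n hmn => by simpa [Function.onFun] using hmn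
  refine Measure.ext_of_singleton fun m => ?_
  induction m using ENat.recTopCoe with
  | coe n => exact h n
  | top =>
    rw [htop, prob_compl_eq_one_sub .of_discrete, prob_compl_eq_one_sub .of_discrete,
      measure_iUnion hdisj fun _ => .of_discrete, measure_iUnion hdisj fun _ => .of_discrete]
    simp_rw [h]

lemma pointCount_eq_tsum {E : Type*} (x : ℕ → E) (B : Set E) :
    ((pointCount x B : ℕ∞) : ℝ≥0∞) = ∑' k, B.indicator 1 (x k) := by
  rw [pointCount, ← ENNReal.tsum_set_one, tsum_subtype {k | x k ∈ B} (fun _ => (1 : ℝ≥0∞))]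
  rfl

lemma simpleFunc_comp_eq_sum_indicator {E R : Type*} [MeasurableSpace E] [Semiring R]
    (φ : ℝ≥0∞ → R) (f : SimpleFunc E ℝ≥0∞) (x : E) :
    φ (f x) = ∑ c : f.range, φ c * (f ⁻¹' {(c : ℝ≥0∞)}).indicator 1 x := by
  classical
  rw [Finset.sum_coe_sort f.range fun c => φ c * (f ⁻¹' {c}).indicator 1 x]
  simp [indicator_apply]

lemma exists_monotone_simpleFunc_tendsto {E : Type*} [MeasurableSpace E] (Λ : Measure E)
    [SigmaFinite Λ] {f : E → ℝ≥0∞} (hf : Measurable f) :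
    ∃ g : ℕ → SimpleFunc E ℝ≥0∞, (∀ n, (g n).FinMeasSupp Λ) ∧ (∀ x, Monotone fun n => g n x) ∧
      ∀ x, Tendsto (fun n => g n x) atTop (𝓝 (f x)) := by
  let g : ℕ → SimpleFunc E ℝ≥0∞ := fun n => (SimpleFunc.eapprox f n).restrict (spanningSets Λ n)
  have hg : ∀ n x, g n x = (spanningSets Λ n).indicator (SimpleFunc.eapprox f n) x := fun n x =>
    SimpleFunc.restrict_apply _ (measurableSet_spanningSets Λ n) x
  refine ⟨g, fun n => ?_, fun x m n hmn => ?_, fun x => ?_⟩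
  · refine SimpleFunc.finMeasSupp_iff_support.2
      ((measure_mono fun x hx => ?_).trans_lt (measure_spanningSets_lt_top Λ n))
    by_contra hxn
    exact hx (by rw [hg, indicator_of_notMem hxn])
  · simp only [hg]
    exact (indicator_le_indicator (SimpleFunc.monotone_eapprox f hmn x)).trans
      (indicator_le_indicator_of_subset (monotone_spanningSets Λ hmn) (fun _ => zero_le) x)
  · have h := tendsto_atTop_iSup (fun m n hmn => SimpleFunc.monotone_eapprox f hmn x :
      Monotone fun n => SimpleFunc.eapprox f n x)
    rw [SimpleFunc.iSup_eapprox_apply hf] at h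
    refine h.congr' ?_
    filter_upwards [eventually_ge_atTop (spanningSetsIndex Λ x)] with n hn
    rw [hg, indicator_of_mem (monotone_spanningSets Λ hn (mem_spanningSetsIndex Λ x))]

namespace IsPoissonProcess

variable {Ω E : Type*} [MeasurableSpace Ω] [MeasurableSpace E] {P : Measure Ω}
  {X : ℕ → Ω → E} {Λ : Measure E}

-- The empty family of sets has independent counts, which forces `P univ = 1`.
lemma isProbabilityMeasure (hX : IsPoissonProcess P X Λ) : IsProbabilityMeasure P :=
  (hX.count_indep 0 (fun _ => ∅) (fun _ => .empty)
    (Subsingleton.pairwise)).isProbabilityMeasure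

lemma measurable_pointCount (hX : IsPoissonProcess P X Λ) {B : Set E}
    (hB : MeasurableSet B) : Measurable fun ω => pointCount (fun k => X k ω) B := by
  have h : Measurable fun ω => ((pointCount (fun k => X k ω) B : ℕ∞) : ℝ≥0∞) := by
    simp_rw [pointCount_eq_tsum]
    exact Measurable.tsum fun k =>
      (measurable_one.indicator hB).comp (hX.measurable k)
  refine measurable_to_countable' fun n => ?_
  have hpre : (fun ω => pointCount (fun k => X k ω) B) ⁻¹' {n}
      = (fun ω => ((pointCount (fun k => X k ω) B : ℕ∞) : ℝ≥0∞)) ⁻¹' {(n : ℝ≥0∞)} := by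
    ext ω
    simp
  rw [hpre]
  exact h (measurableSet_singleton _)

lemma map_pointCount (hX : IsPoissonProcess P X Λ) {B : Set E} (hB : MeasurableSet B)
    (hΛ : Λ B ≠ ∞) :
    P.map (fun ω => pointCount (fun k => X k ω) B)
      = (poissonMeasure (Λ B).toNNReal).map (fun n : ℕ => (n : ℕ∞)) := by
  have := hX.isProbabilityMeasure
  have hN := hX.measurable_pointCount hB
  have hcast : Measurable (fun n : ℕ => (n : ℕ∞)) := .of_discrete
  have := Measure.isProbabilityMeasure_map (μ := P) hN.aemeasurable
  have := Measure.isProbabilityMeasure_map (μ := poissonMeasure (Λ B).toNNReal)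
    hcast.aemeasurable
  refine measure_eq_of_forall_natCast fun n => ?_
  rw [Measure.map_apply hN .of_discrete, Measure.map_apply hcast .of_discrete,
    ← image_singleton, preimage_image_eq _ Nat.cast_injective, ← hX.count_law B hB hΛ n,
    image_singleton]
  rfl

lemma lintegral_expNeg_mul_pointCount (hX : IsPoissonProcess P X Λ) {B : Set E}
    (hB : MeasurableSet B) {c : ℝ≥0∞} (hΛ : c ≠ 0 → Λ B ≠ ∞) :
    ∫⁻ ω, expNeg (c * (pointCount (fun k => X k ω) B : ℕ∞)) ∂P
      = expNeg (Λ B * (1 - expNeg c)) := by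
  have := hX.isProbabilityMeasure
  rcases eq_or_ne c 0 with rfl | hc
  · simp
  calc ∫⁻ ω, expNeg (c * (pointCount (fun k => X k ω) B : ℕ∞)) ∂P
      = ∫⁻ m : ℕ∞, expNeg (c * m) ∂(P.map fun ω => pointCount (fun k => X k ω) B) :=
        (lintegral_map (f := fun m : ℕ∞ => expNeg (c * (m : ℝ≥0∞))) .of_discrete
          (hX.measurable_pointCount hB)).symm
    _ = ∫⁻ n : ℕ, expNeg (c * (n : ℕ∞)) ∂(poissonMeasure (Λ B).toNNReal) := by
        rw [hX.map_pointCount hB (hΛ hc), lintegral_map .of_discrete .of_discrete]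
    _ = ∫⁻ n : ℕ, expNeg c ^ n ∂(poissonMeasure (Λ B).toNNReal) := by
        simp_rw [ENat.toENNReal_coe, expNeg_mul_natCast]
    _ = expNeg (Λ B * (1 - expNeg c)) := by
        rw [lintegral_pow_poissonMeasure _ (expNeg_le_one c), ENNReal.coe_toNNReal (hΛ hc)]

lemma iIndepFun_pointCount (hX : IsPoissonProcess P X Λ) {ι : Type*} [Finite ι] {B : ι → Set E}
    (hB : ∀ i, MeasurableSet (B i)) (hd : Pairwise (Function.onFun Disjoint B)) :
    iIndepFun (fun i ω => pointCount (fun k => X k ω) (B i)) P := by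
  let e := Finite.equivFin ι
  simpa using! (hX.count_indep _ (B ∘ e.symm) (fun i => hB _)
    (hd.comp_of_injective e.symm.injective)).precomp e.injective

lemma laplace_of_disjoint (hX : IsPoissonProcess P X Λ) {ι : Type*} [Fintype ι] {B : ι → Set E}
    (hB : ∀ i, MeasurableSet (B i)) (hd : Pairwise (Function.onFun Disjoint B))
    {c : ι → ℝ≥0∞} (hΛ : ∀ i, c i ≠ 0 → Λ (B i) ≠ ∞) :
    ∫⁻ ω, expNeg (∑ i, c i * (pointCount (fun k => X k ω) (B i) : ℕ∞)) ∂P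
      = expNeg (∑ i, Λ (B i) * (1 - expNeg (c i))) := by
  have hind := (hX.iIndepFun_pointCount hB hd).comp
    (fun i (n : ℕ∞) => c i * (n : ℝ≥0∞)) (fun i => .of_discrete)
  rw [expNeg_sum, ← Finset.prod_congr rfl fun i _ =>
    hX.lintegral_expNeg_mul_pointCount (hB i) (hΛ i)]
  exact lintegral_expNeg_sum_of_iIndepFun
    (fun i => Measurable.of_discrete.comp (hX.measurable_pointCount (hB i))) hind Finset.univ

lemma laplace_simpleFunc (hX : IsPoissonProcess P X Λ) {f : SimpleFunc E ℝ≥0∞}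
    (hf : f.FinMeasSupp Λ) :
    ∫⁻ ω, expNeg (∑' k, f (X k ω)) ∂P = expNeg (∫⁻ x, (1 - expNeg (f x)) ∂Λ) := by
  let B : f.range → Set E := fun c => f ⁻¹' {(c : ℝ≥0∞)}
  have hB : ∀ c, MeasurableSet (B c) := fun c => f.measurableSet_fiber _
  have hd : Pairwise (Function.onFun Disjoint B) := fun c d hcd =>
    Disjoint.preimage _ (by simpa using Subtype.coe_injective.ne hcd)
  have hsum : ∀ ω, ∑' k, f (X k ω)
      = ∑ c : f.range, (c : ℝ≥0∞) * (pointCount (fun k => X k ω) (B c) : ℕ∞) := fun ω => by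
    simp_rw [pointCount_eq_tsum, ← ENNReal.tsum_mul_left]
    rw [← Summable.tsum_finsetSum (fun _ _ => ENNReal.summable)]
    exact tsum_congr fun k => simpleFunc_comp_eq_sum_indicator id f _
  have hint : ∫⁻ x, (1 - expNeg (f x)) ∂Λ = ∑ c : f.range, Λ (B c) * (1 - expNeg c) := by
    simp_rw [simpleFunc_comp_eq_sum_indicator (fun t => 1 - expNeg t) f]
    rw [lintegral_finsetSum _ fun c _ => (measurable_one.indicator (hB c)).const_mul _]
    refine Finset.sum_congr rfl fun c _ => ?_
    rw [lintegral_const_mul _ (measurable_one.indicator (hB c)), lintegral_indicator_one (hB c),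
      mul_comm]
  simp_rw [hsum, hint]
  exact hX.laplace_of_disjoint hB hd fun c hc => (SimpleFunc.finMeasSupp_iff.1 hf c hc).ne

theorem laplace [SigmaFinite Λ] (hX : IsPoissonProcess P X Λ) {f : E → ℝ≥0∞}
    (hf : Measurable f) :
    ∫⁻ ω, expNeg (∑' k, f (X k ω)) ∂P = expNeg (∫⁻ x, (1 - expNeg (f x)) ∂Λ) := by
  have := hX.isProbabilityMeasure
  obtain ⟨g, hfin, hmono, htend⟩ := exists_monotone_simpleFunc_tendsto Λ hf
  have htsum : ∀ ω, Tendsto (fun n => ∑' k, g n (X k ω)) atTop (𝓝 (∑' k, f (X k ω))) :=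
    fun ω => by
      simp_rw [← lintegral_count]
      exact lintegral_tendsto_of_tendsto_of_monotone (fun n => Measurable.of_discrete.aemeasurable)
        (.of_forall fun k => hmono _) (.of_forall fun k => htend _)
  have hleft := tendsto_lintegral_expNeg (P := P)
    (fun n => Measurable.tsum fun k => (g n).measurable.comp (hX.measurable k)) htsum
  have hright : Tendsto (fun n => ∫⁻ x, (1 - expNeg (g n x)) ∂Λ) atTop
      (𝓝 (∫⁻ x, (1 - expNeg (f x)) ∂Λ)) := by
    refine lintegral_tendsto_of_tendsto_of_monotone
      (fun n => (measurable_const.sub (measurable_expNeg.comp (g n).measurable)).aemeasurable)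
      (.of_forall fun x m n hmn => tsub_le_tsub_left (expNeg_antitone (hmono x hmn)) 1)
      (.of_forall fun x => ?_)
    exact ENNReal.Tendsto.sub tendsto_const_nhds ((continuous_expNeg.tendsto _).comp (htend x))
      (.inl ENNReal.one_ne_top)
  exact tendsto_nhds_unique (hleft.congr fun n => hX.laplace_simpleFunc (hfin n))
    ((continuous_expNeg.tendsto _).comp hright)

/-- Independent marks with law `ν` turn the process into one with intensity `Λ ⊗ ν`: given the
points, a mark at `x` contributes the factor `∫ exp (-f (x, u)) ν(du)`, which is `exp` of minus a
function of `x`, so that `laplace` applies. -/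
theorem laplace_marked [SigmaFinite Λ] (hX : IsPoissonProcess P X Λ) {M : Type*}
    [MeasurableSpace M] {ν : Measure M} {h : ℕ → Ω → M} (hm : ∀ k, Measurable (h k))
    (hlaw : ∀ k, P.map (h k) = ν) (hind : iIndepFun h P)
    (hXh : IndepFun (fun ω k => X k ω) (fun ω k => h k ω) P)
    {f : E × M → ℝ≥0∞} (hf : Measurable f) :
    ∫⁻ ω, expNeg (∑' k, f (X k ω, h k ω)) ∂P
      = expNeg (∫⁻ x, ∫⁻ u, (1 - expNeg (f (x, u))) ∂ν ∂Λ) := by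
  have := hX.isProbabilityMeasure
  have : IsProbabilityMeasure ν := hlaw 0 ▸ Measure.isProbabilityMeasure_map (hm 0).aemeasurable
  have hXm : Measurable fun (ω : Ω) (k : ℕ) => X k ω := measurable_pi_lambda _ hX.measurable
  have hhm : Measurable fun (ω : Ω) (k : ℕ) => h k ω := measurable_pi_lambda _ hm
  have := Measure.isProbabilityMeasure_map (μ := P) hhm.aemeasurable
  have hF : Measurable fun z : (ℕ → E) × (ℕ → M) => expNeg (∑' k, f (z.1 k, z.2 k)) := by
    fun_prop
  calc ∫⁻ ω, expNeg (∑' k, f (X k ω, h k ω)) ∂P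
      = ∫⁻ x, ∫⁻ y, expNeg (∑' k, f (x k, y k)) ∂(P.map fun ω k => h k ω)
          ∂(P.map fun ω k => X k ω) := by
        rw [← lintegral_prod _ hF.aemeasurable, ← (indepFun_iff_map_prod_eq_prod_map_map
          hXm.aemeasurable hhm.aemeasurable).1 hXh, lintegral_map hF (hXm.prodMk hhm)]
    _ = ∫⁻ ω, expNeg (∑' k, negLog (∫⁻ u, expNeg (f (X k ω, u)) ∂ν)) ∂P := by
        rw [← lintegral_map (f := fun x : ℕ → E =>
          expNeg (∑' k, negLog (∫⁻ u, expNeg (f (x k, u)) ∂ν))) (by fun_prop) hXm]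
        refine lintegral_congr fun x => ?_
        rw [lintegral_map (by fun_prop) hhm]
        exact lintegral_expNeg_tsum_comp_of_iIndepFun hm hlaw hind
          (φ := fun k u => f (x k, u)) fun k => by fun_prop
    _ = expNeg (∫⁻ x, ∫⁻ u, (1 - expNeg (f (x, u))) ∂ν ∂Λ) := by
        rw [hX.laplace (f := fun x => negLog (∫⁻ u, expNeg (f (x, u)) ∂ν)) (by fun_prop)]
        simp only [expNeg_negLog (lintegral_expNeg_le_one _)]
        congr! 3 with x
        exact (lintegral_one_sub_expNeg (by fun_prop)).symm

lemma measureReal_forall_notMem (hX : IsPoissonProcess P X Λ) {B : Set E}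
    (hB : MeasurableSet B) (hΛ : Λ B ≠ ∞) :
    P.real {ω | ∀ k, X k ω ∉ B} = Real.exp (-Λ.real B) := by
  have hevent : {ω | ∀ k, X k ω ∉ B}
      = {ω | pointCount (fun k => X k ω) B = (0 : ℕ)} := by
    ext ω
    simp [pointCount, Set.eq_empty_iff_forall_notMem]
  rw [hevent, Measure.real, hX.count_law B hB hΛ 0, poissonMeasure_singleton]
  simp [Measure.real, Real.exp_nonneg, ENNReal.coe_toNNReal_eq_toReal]

end IsPoissonProcess

/-! ### Exponential fading -/

section ExpMeasure

variable {r : ℝ}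

lemma expMeasure_Iic (hr : 0 < r) {x : ℝ} (hx : 0 ≤ x) :
    expMeasure r (Iic x) = ENNReal.ofReal (1 - Real.exp (-(r * x))) := by
  have := isProbabilityMeasure_expMeasure hr
  rw [← ofReal_measureReal, ← cdf_eq_real, cdf_expMeasure_eq hr, if_pos hx]

lemma ae_pos_expMeasure (hr : 0 < r) : ∀ᵐ u ∂(expMeasure r), 0 < u := by
  have h0 := expMeasure_Iic hr le_rfl
  rw [mul_zero, neg_zero, Real.exp_zero, sub_self, ENNReal.ofReal_zero] at h0
  simpa only [ae_iff, not_lt] using! h0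

lemma expMeasure_le_ofReal (hr : 0 < r) (t : ℝ≥0∞) :
    expMeasure r {u | t ≤ ENNReal.ofReal u} = expNeg (ENNReal.ofReal r * t) := by
  have := isProbabilityMeasure_expMeasure hr
  have : NullSingletonClass (expMeasure r) := by
    unfold expMeasure gammaMeasure
    infer_instance
  induction t with
  | top => simp [ENNReal.mul_top (ENNReal.ofReal_pos.2 hr).ne']
  | coe t =>
    rcases eq_or_ne t 0 with rfl | ht
    · simp
    have hset : {u | (t : ℝ≥0∞) ≤ ENNReal.ofReal u} = Ici (t : ℝ) := by
      ext u
      rw [mem_ofPred_eq, ← ENNReal.ofReal_coe_nnreal, ENNReal.ofReal_le_ofReal_iff', mem_Ici,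
        or_iff_left (not_le.2 (NNReal.coe_pos.2 (pos_iff_ne_zero.2 ht)))]
    rw [hset, measure_congr Ioi_ae_eq_Ici.symm, ← compl_Iic,
      prob_compl_eq_one_sub measurableSet_Iic, expMeasure_Iic hr t.coe_nonneg,
      ← ENNReal.ofReal_coe_nnreal, ← ENNReal.ofReal_mul hr.le,
      ← one_sub_expNeg_ofReal (by positivity),
      ENNReal.sub_sub_cancel ENNReal.one_ne_top (expNeg_le_one _)]

lemma integrable_rpow_expMeasure (hr : 0 < r) {s : ℝ} (hs : -1 < s) :
    Integrable (fun u : ℝ => u ^ s) (expMeasure r) := by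
  have hpdf : Measurable (gammaPDF 1 r) := (measurable_gammaPDFReal 1 r).ennreal_ofReal
  unfold expMeasure gammaMeasure
  rw [integrable_withDensity_iff_integrable_smul' hpdf
    (.of_forall fun _ => ENNReal.ofReal_lt_top)]
  have hint := (integrableOn_rpow_mul_exp_neg_mul_rpow hs one_pos hr).const_mul r
  rw [← IntegrableOn, ← integrable_indicator_iff measurableSet_Ioi] at hint
  refine hint.congr ?_
  filter_upwards [compl_mem_ae_iff.2 (measure_singleton (0 : ℝ))] with u hu
  rcases lt_or_gt_of_ne (show u ≠ 0 from hu) with hneg | hpos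
  · simp [gammaPDF_of_neg hneg, hneg.le]
  · rw [indicator_of_mem (mem_Ioi.2 hpos), gammaPDF_of_nonneg hpos.le,
      ENNReal.toReal_ofReal (by positivity)]
    simp
    ring

lemma integrable_expMeasure_of_le_add_rpow (hr : 0 < r) {F : ℝ → ℝ} {b c s : ℝ} (hs : -1 < s)
    (hF : ContinuousOn F (Ioi 0)) (hF0 : ∀ u, 0 < u → 0 ≤ F u)
    (hle : ∀ u, 0 < u → F u ≤ b + c * u ^ s) : Integrable F (expMeasure r) := by
  have := isProbabilityMeasure_expMeasure hr
  have hpos := ae_pos_expMeasure hr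
  refine ((integrable_const b).add ((integrable_rpow_expMeasure hr hs).const_mul c)).mono' ?_ ?_
  · rw [← Measure.restrict_eq_self_of_ae_mem (s := Ioi 0) hpos]
    exact hF.aestronglyMeasurable measurableSet_Ioi
  · filter_upwards [hpos] with u hu
    rw [Real.norm_of_nonneg (hF0 u hu)]
    exact hle u hu

lemma measure_le_ofReal_of_indepFun {Ω : Type*} [MeasurableSpace Ω] {P : Measure Ω}
    [IsFiniteMeasure P] (hr : 0 < r) {Y : Ω → ℝ} (hY : Measurable Y)
    (hlaw : P.map Y = expMeasure r) {V : Ω → ℝ≥0∞} (hV : Measurable V) (hind : IndepFun Y V P) :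
    P {ω | V ω ≤ ENNReal.ofReal (Y ω)} = ∫⁻ ω, expNeg (ENNReal.ofReal r * V ω) ∂P := by
  have hS : MeasurableSet {z : ℝ × ℝ≥0∞ | z.2 ≤ ENNReal.ofReal z.1} :=
    measurableSet_le (by fun_prop) (by fun_prop)
  have hjoint := (indepFun_iff_map_prod_eq_prod_map_map hY.aemeasurable hV.aemeasurable).1 hind
  calc P {ω | V ω ≤ ENNReal.ofReal (Y ω)}
      = P.map (fun ω => (Y ω, V ω)) {z | z.2 ≤ ENNReal.ofReal z.1} :=
        (Measure.map_apply (hY.prodMk hV) hS).symm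
    _ = ∫⁻ v, expMeasure r {u | v ≤ ENNReal.ofReal u} ∂(P.map V) := by
        have := isProbabilityMeasure_expMeasure hr
        rw [hjoint, hlaw, Measure.prod_apply_symm hS]
        rfl
    _ = ∫⁻ ω, expNeg (ENNReal.ofReal r * V ω) ∂P := by
        simp_rw [expMeasure_le_ofReal hr]
        exact lintegral_map (by fun_prop) hV

end ExpMeasure

/-! ### Interference and coverage -/

/-- Total power received from transmitters at the points `x k` with fading `h k`, when a
transmitter at `y` with unit fading is received with power `g y`. The value `g y = ∞` is allowed:
it models the virtual gains of the protocol model. -/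
noncomputable def interference {E : Type*} (g : E → ℝ≥0∞) (x : ℕ → E) (h : ℕ → ℝ) : ℝ≥0∞ :=
  ∑' k, ENNReal.ofReal (h k) * g (x k)

lemma add_interference_ite_top_le_iff {E : Type*} (p : E → Prop) [DecidablePred p]
    (g : E → ℝ≥0∞) (x : ℕ → E) {h : ℕ → ℝ} (hh : ∀ k, 0 < h k) (t : ℝ≥0∞) {b : ℝ≥0∞}
    (hb : b ≠ ∞) :
    t + interference (fun y => if p y then ∞ else g y) x h ≤ b
      ↔ (∀ k, ¬ p (x k)) ∧ t + interference g x h ≤ b := by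
  by_cases hp : ∀ k, ¬ p (x k)
  · simp [interference, hp]
  · obtain ⟨k, hk⟩ := not_forall_not.1 hp
    have htop : interference (fun y => if p y then ∞ else g y) x h = ∞ :=
      top_le_iff.1 (le_trans (by simp [hk, hh k, ENNReal.mul_top]) (ENNReal.le_tsum k))
    simp only [htop, add_top, top_le_iff, hb, hp, false_and]

lemma measurable_interference {E : Type*} [MeasurableSpace E] {g : E → ℝ≥0∞}
    (hg : Measurable g) :
    Measurable fun z : (ℕ → E) × (ℕ → ℝ) => interference g z.1 z.2 := by
  unfold interference
  fun_prop

namespace IsRayleighPoissonNetwork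

variable {Ω : Type*} [MeasurableSpace Ω] {P : Measure Ω} {lam : ℝ}
  {X : ℕ → Ω → Plane} {h₀ : Ω → ℝ} {h : ℕ → Ω → ℝ}

lemma ae_pos_h₀ (hnet : IsRayleighPoissonNetwork P lam X h₀ h) : ∀ᵐ ω ∂P, 0 < h₀ ω :=
  ae_of_ae_map hnet.measurable_h₀.aemeasurable (hnet.law_h₀ ▸ ae_pos_expMeasure one_pos)

lemma ae_pos_h (hnet : IsRayleighPoissonNetwork P lam X h₀ h) : ∀ᵐ ω ∂P, ∀ k, 0 < h k ω :=
  ae_all_iff.2 fun k =>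
    ae_of_ae_map (hnet.measurable_h k).aemeasurable (hnet.law_h k ▸ ae_pos_expMeasure one_pos)

lemma lintegral_expNeg_interference (hnet : IsRayleighPoissonNetwork P lam X h₀ h)
    {g : Plane → ℝ≥0∞} (hg : Measurable g) :
    ∫⁻ ω, expNeg (interference g (fun k => X k ω) (fun k => h k ω)) ∂P
      = expNeg (ENNReal.ofReal lam *
          ∫⁻ u, ∫⁻ x, (1 - expNeg (ENNReal.ofReal u * g x)) ∂(volume : Measure Plane)
            ∂(expMeasure 1)) := by
  have : SigmaFinite (ENNReal.ofReal lam • (volume : Measure Plane)) :=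
    SMul.sigmaFinite lam.toNNReal
  have := isProbabilityMeasure_expMeasure one_pos
  refine (hnet.poisson.laplace_marked hnet.measurable_h hnet.law_h hnet.indep_h hnet.indep_X_h
    (f := fun z => ENNReal.ofReal z.2 * g z.1) (by fun_prop)).trans ?_
  rw [lintegral_smul_measure, smul_eq_mul, lintegral_lintegral_swap (by fun_prop)]

lemma coverage (hnet : IsRayleighPoissonNetwork P lam X h₀ h)
    {g : Plane → ℝ≥0∞} (hg : Measurable g) (t : ℝ≥0∞) :
    P {ω | t + interference g (fun k => X k ω) (fun k => h k ω) ≤ ENNReal.ofReal (h₀ ω)}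
      = expNeg (t + ENNReal.ofReal lam *
          ∫⁻ u, ∫⁻ x, (1 - expNeg (ENNReal.ofReal u * g x)) ∂(volume : Measure Plane)
            ∂(expMeasure 1)) := by
  have := hnet.poisson.isProbabilityMeasure
  have hT := (measurable_interference hg).const_add t
  have hXh : Measurable fun ω => ((fun k => X k ω), (fun k => h k ω)) :=
    (measurable_pi_lambda _ hnet.poisson.measurable).prodMk
      (measurable_pi_lambda _ hnet.measurable_h)
  refine (measure_le_ofReal_of_indepFun one_pos hnet.measurable_h₀ hnet.law_h₀ (hT.comp hXh)
    (hnet.indep_h₀.comp measurable_id hT)).trans ?_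
  simp only [Function.comp_def, ENNReal.ofReal_one, one_mul, expNeg_add]
  rw [lintegral_const_mul' _ _ (expNeg_ne_top t), hnet.lintegral_expNeg_interference hg]

lemma measureReal_coverage (hnet : IsRayleighPoissonNetwork P lam X h₀ h) (hlam : 0 ≤ lam)
    {g : Plane → ℝ≥0∞} (hg : Measurable g) {F : ℝ → ℝ} (hF : Integrable F (expMeasure 1))
    (hF0 : ∀ u, 0 < u → 0 ≤ F u)
    (hgF : ∀ u, 0 < u → ∫⁻ x, (1 - expNeg (ENNReal.ofReal u * g x))
      = ENNReal.ofReal (Real.pi * F u)) {t : ℝ} (ht : 0 ≤ t) :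
    P.real {ω | ENNReal.ofReal t + interference g (fun k => X k ω) (fun k => h k ω)
        ≤ ENNReal.ofReal (h₀ ω)}
      = Real.exp (-t - Real.pi * lam * ∫ u, F u ∂(expMeasure 1)) := by
  have hpos := ae_pos_expMeasure one_pos
  have hnonneg : 0 ≤ᵐ[expMeasure 1] fun u => Real.pi * F u := by
    filter_upwards [hpos] with u hu using mul_nonneg Real.pi_pos.le (hF0 u hu)
  have hmean : ∫⁻ u, ∫⁻ x, (1 - expNeg (ENNReal.ofReal u * g x)) ∂(volume : Measure Plane)
      ∂(expMeasure 1) = ENNReal.ofReal (∫ u, Real.pi * F u ∂(expMeasure 1)) := by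
    rw [ofReal_integral_eq_lintegral_ofReal (hF.const_mul _) hnonneg]
    refine lintegral_congr_ae ?_
    filter_upwards [hpos] with u hu using hgF u hu
  have hint := integral_nonneg_of_ae hnonneg
  rw [measureReal_def, hnet.coverage hg, hmean, ← ENNReal.ofReal_mul hlam,
    ← ENNReal.ofReal_add ht (by positivity), expNeg_ofReal (by positivity),
    ENNReal.toReal_ofReal (Real.exp_pos _).le, integral_const_mul]
  ring_nf

end IsRayleighPoissonNetwork

/-! ### Radial integrals -/

section Radial

variable {E : Type*} [NormedAddCommGroup E] [NormedSpace ℝ E] [MeasurableSpace E] [BorelSpace E]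
  [FiniteDimensional ℝ E] [Nontrivial E]

lemma lintegral_fun_norm_addHaar (μ : Measure E) [μ.IsAddHaarMeasure] {F : ℝ → ℝ≥0∞}
    (hF : Measurable F) :
    ∫⁻ x, F ‖x‖ ∂μ = Module.finrank ℝ E * μ (Metric.ball 0 1)
      * ∫⁻ r in Ioi 0, ENNReal.ofReal (r ^ (Module.finrank ℝ E - 1)) * F r := by
  have hF' : Measurable fun r : Ioi (0 : ℝ) => F r := hF.comp measurable_subtype_coe
  calc ∫⁻ x, F ‖x‖ ∂μ
      = ∫⁻ x : ({0}ᶜ : Set E), F ‖x.1‖ ∂(μ.comap (↑)) := by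
        rw [lintegral_subtype_comap (measurableSet_singleton _).compl fun x : E => F ‖x‖,
          restrict_compl_singleton]
    _ = ∫⁻ x, F x.2 ∂(μ.toSphere.prod (.volumeIoiPow (Module.finrank ℝ E - 1))) := by
        simpa only [Function.comp_def, homeomorphUnitSphereProd_apply_snd_coe] using
          μ.measurePreserving_homeomorphUnitSphereProd.lintegral_comp (hF'.comp measurable_snd)
    _ = μ.toSphere univ * ∫⁻ r : Ioi (0 : ℝ), F r ∂(.volumeIoiPow (Module.finrank ℝ E - 1)) := by
        refine (lintegral_prod _ (hF'.comp measurable_snd).aemeasurable).trans ?_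
        simp only [Function.comp_apply, lintegral_const, mul_comm]
    _ = _ := by
        rw [Measure.toSphere_apply_univ, Measure.volumeIoiPow,
          lintegral_withDensity_eq_lintegral_mul _ (by fun_prop) hF']
        simp only [Pi.mul_apply]
        rw [lintegral_subtype_comap measurableSet_Ioi
          fun r : ℝ => ENNReal.ofReal (r ^ (Module.finrank ℝ E - 1)) * F r]

end Radial

lemma lintegral_Ioc_of_hasDerivAt_of_nonneg {f f' : ℝ → ℝ} {a b : ℝ} (hab : a ≤ b)
    (hf : ∀ x ∈ Icc a b, HasDerivAt f (f' x) x) (hf' : ∀ x ∈ Ioc a b, 0 ≤ f' x) :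
    ∫⁻ x in Ioc a b, ENNReal.ofReal (f' x) = ENNReal.ofReal (f b - f a) := by
  have hint : IntegrableOn f' (Ioc a b) := intervalIntegral.integrableOn_deriv_of_nonneg
    (fun x hx => (hf x hx).continuousAt.continuousWithinAt)
    (fun x hx => hf x (Ioo_subset_Icc_self hx)) (fun x hx => hf' x (Ioo_subset_Ioc_self hx))
  rw [← ofReal_integral_eq_lintegral_ofReal hint (ae_restrict_of_forall_mem measurableSet_Ioc hf'),
    ← intervalIntegral.integral_of_le hab, intervalIntegral.integral_eq_sub_of_hasDerivAt
      (fun x hx => hf x (uIcc_of_le hab ▸ hx))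
      ((intervalIntegrable_iff_integrableOn_Ioc_of_le hab).2 hint)]

lemma lintegral_Ioi_of_hasDerivAt_of_nonneg {f f' : ℝ → ℝ} {a l : ℝ}
    (hf : ∀ x ∈ Ici a, HasDerivAt f (f' x) x) (hf' : ∀ x ∈ Ioi a, 0 ≤ f' x)
    (hlim : Tendsto f atTop (𝓝 l)) :
    ∫⁻ x in Ioi a, ENNReal.ofReal (f' x) = ENNReal.ofReal (l - f a) := by
  rw [← integral_Ioi_of_hasDerivAt_of_nonneg' hf hf' hlim, ofReal_integral_eq_lintegral_ofReal
    (integrableOn_Ioi_deriv_of_nonneg' hf hf' hlim)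
    (ae_restrict_of_forall_mem measurableSet_Ioi hf')]

lemma lintegral_Ioc_two_mul {a b : ℝ} (ha : 0 ≤ a) (hab : a ≤ b) :
    ∫⁻ r in Ioc a b, ENNReal.ofReal (2 * r) = ENNReal.ofReal (b ^ 2 - a ^ 2) :=
  lintegral_Ioc_of_hasDerivAt_of_nonneg (f := fun r => r ^ 2) hab
    (fun r _ => by simpa using hasDerivAt_pow 2 r) (fun r hr => by linarith [hr.1])

lemma lintegral_plane_of_eq_on_disk {F : ℝ → ℝ≥0∞} (hF : Measurable F) {a : ℝ} (ha : 0 ≤ a)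
    {c : ℝ≥0∞} (hc : ∀ r, r < a → F r = c) :
    ∫⁻ x : Plane, F ‖x‖ = ENNReal.ofReal Real.pi *
      (ENNReal.ofReal (a ^ 2) * c + ∫⁻ r in Ioi a, ENNReal.ofReal (2 * r) * F r) := by
  have hdisk : ∫⁻ r in Ioc 0 a, ENNReal.ofReal (2 * r) * F r = ENNReal.ofReal (a ^ 2) * c := by
    rw [← Measure.restrict_congr_set Ioo_ae_eq_Ioc,
      setLIntegral_congr_fun measurableSet_Ioo fun r hr => by rw [hc r hr.2],
      lintegral_mul_const _ (by fun_prop), Measure.restrict_congr_set Ioo_ae_eq_Ioc,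
      lintegral_Ioc_two_mul le_rfl ha]
    simp
  rw [← hdisk, ← lintegral_union measurableSet_Ioi (Ioc_disjoint_Ioi le_rfl),
    Ioc_union_Ioi_eq_Ioi ha, lintegral_fun_norm_addHaar _ hF, finrank_euclideanSpace_fin,
    EuclideanSpace.volume_ball_fin_two]
  simp_rw [ENNReal.ofReal_mul (zero_le_two (α := ℝ)), mul_assoc]
  rw [lintegral_const_mul _ (by fun_prop)]
  simp
  ring

/-! ### The upper incomplete Gamma function -/

lemma integrableOn_rpow_mul_exp_neg_Ioi (s : ℝ) {x : ℝ} (hx : 0 < x) :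
    IntegrableOn (fun t : ℝ => t ^ (s - 1) * Real.exp (-t)) (Ioi x) := by
  refine integrable_of_isBigO_exp_neg (b := 1 / 2) (by norm_num) (fun t ht => ?_) ?_
  · exact ((Real.continuousAt_rpow_const t _ (.inl (hx.trans_le ht).ne')).mul
      (by fun_prop)).continuousWithinAt
  · simpa only [mul_comm] using (Real.Gamma_integrand_isLittleO (s - 1)).isBigO

lemma upperGamma_nonneg (s : ℝ) {x : ℝ} (hx : 0 ≤ x) : 0 ≤ upperGamma s x :=
  setIntegral_nonneg measurableSet_Ioi fun t ht => by
    have := hx.trans_lt ht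
    positivity

lemma hasDerivAt_upperGamma (s : ℝ) {x : ℝ} (hx : 0 < x) :
    HasDerivAt (upperGamma s) (-(x ^ (s - 1) * Real.exp (-x))) x := by
  have hcont : ContinuousOn (fun t : ℝ => t ^ (s - 1) * Real.exp (-t)) (Ioi 0) := fun t ht =>
    ((Real.continuousAt_rpow_const t _ (.inl (ne_of_gt ht))).mul
      (by fun_prop)).continuousWithinAt
  have hint := integrableOn_rpow_mul_exp_neg_Ioi s (half_pos hx)
  have hder := (intervalIntegral.integral_hasDerivAt_right
    ((intervalIntegrable_iff_integrableOn_Ioc_of_le (half_le_self hx.le)).2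
      (hint.mono_set Ioc_subset_Ioi_self))
    (hcont.stronglyMeasurableAtFilter isOpen_Ioi x hx)
    (hcont.continuousAt (Ioi_mem_nhds hx))).const_sub (upperGamma s (x / 2))
  refine hder.congr_of_eventuallyEq ?_
  filter_upwards [Ioi_mem_nhds (half_lt_self hx)] with y hy
  rw [upperGamma, upperGamma, ← intervalIntegral.integral_Ioi_sub_Ioi hint (le_of_lt hy),
    sub_sub_cancel]

lemma tendsto_upperGamma_zero {s : ℝ} (hs : 0 < s) :
    Tendsto (upperGamma s) (𝓝[>] 0) (𝓝 (Real.Gamma s)) := by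
  have hint : IntegrableOn (fun t : ℝ => t ^ (s - 1) * Real.exp (-t)) (Ioi 0) := by
    simpa only [mul_comm] using Real.GammaIntegral_convergent hs
  have hzero : Real.Gamma s = upperGamma s 0 := by
    rw [Real.Gamma_eq_integral hs, upperGamma]
    simp only [mul_comm]
  rw [hzero]
  exact hint.continuousWithinAt_Ici_primitive_Ioi.tendsto.mono_left
    (nhdsWithin_mono _ Ioi_subset_Ici_self)

/-! ### Integrals of `1 - exp (-s d ^ (-α))` over annuli -/

lemma one_sub_exp_neg_nonneg {x : ℝ} (hx : 0 ≤ x) : 0 ≤ 1 - Real.exp (-x) := by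
  simpa using hx

lemma one_sub_exp_neg_le_one (x : ℝ) : 1 - Real.exp (-x) ≤ 1 := by
  linarith [Real.exp_pos (-x)]

/-- An antiderivative of `d ↦ 2 d (1 - exp (-s d ^ (-α)))` on `d > 0`, obtained by integrating by
parts and substituting `t = s d ^ (-α)`. All three closed forms of the model are differences of its
values. -/
noncomputable def ringPrimitive (α s d : ℝ) : ℝ :=
  d ^ 2 * (1 - Real.exp (-(s * d ^ (-α))))
    + s ^ (2 / α) * upperGamma (1 - 2 / α) (s * d ^ (-α))

section RingPrimitive

variable {α s a b d : ℝ}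

lemma hasDerivAt_ringPrimitive (hα : 0 < α) (hs : 0 < s) (hd : 0 < d) :
    HasDerivAt (ringPrimitive α s) (2 * d * (1 - Real.exp (-(s * d ^ (-α))))) d := by
  have hpow : HasDerivAt (fun d : ℝ => s * d ^ (-α)) (s * (-α * d ^ (-α - 1))) d :=
    (Real.hasDerivAt_rpow_const (.inl hd.ne')).const_mul s
  have hgamma := (hasDerivAt_upperGamma (1 - 2 / α) (by positivity : 0 < s * d ^ (-α))).comp d hpow
  have hcancel : s ^ (2 / α) * (s * d ^ (-α)) ^ (1 - 2 / α - 1) = d ^ 2 := by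
    rw [show 1 - 2 / α - 1 = -(2 / α) by ring, Real.mul_rpow hs.le (by positivity), ← mul_assoc,
      ← Real.rpow_add hs, add_neg_cancel, Real.rpow_zero, one_mul, ← Real.rpow_mul hd.le,
      show -α * -(2 / α) = 2 by field_simp, Real.rpow_two]
  refine (((hasDerivAt_pow 2 d).mul (hpow.neg.exp.const_sub 1)).add
    (hgamma.const_mul (s ^ (2 / α)))).congr_deriv ?_
  simp only [Pi.neg_apply]
  linear_combination (Real.exp (-(s * d ^ (-α))) * s * α * d ^ (-α - 1)) * hcancel

lemma continuousOn_ringPrimitive (α : ℝ) (hd : 0 < d) :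
    ContinuousOn (fun s => ringPrimitive α s d) (Ioi 0) := fun s hs => by
  have hs : 0 < s := hs
  have hgamma : ContinuousAt (fun s => upperGamma (1 - 2 / α) (s * d ^ (-α))) s :=
    (hasDerivAt_upperGamma _ (by positivity)).continuousAt.comp (by fun_prop)
  exact ((by fun_prop : ContinuousAt (fun s => d ^ 2 * (1 - Real.exp (-(s * d ^ (-α))))) s).add
    ((Real.continuousAt_rpow_const s _ (.inl hs.ne')).mul hgamma)).continuousWithinAt

lemma ringPrimitive_nonneg (α : ℝ) (hs : 0 ≤ s) (hd : 0 ≤ d) : 0 ≤ ringPrimitive α s d := by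
  have hu : 0 ≤ s * d ^ (-α) := by positivity
  have := one_sub_exp_neg_nonneg hu
  have := upperGamma_nonneg (1 - 2 / α) hu
  unfold ringPrimitive
  positivity

lemma two_mul_one_sub_exp_neg_nonneg (α : ℝ) (hs : 0 ≤ s) (hd : 0 ≤ d) :
    0 ≤ 2 * d * (1 - Real.exp (-(s * d ^ (-α)))) :=
  mul_nonneg (by positivity) (one_sub_exp_neg_nonneg (by positivity))

lemma monotoneOn_ringPrimitive (hα : 0 < α) (hs : 0 < s) :
    MonotoneOn (ringPrimitive α s) (Ioi 0) := by
  refine monotoneOn_of_hasDerivWithinAt_nonneg (convex_Ioi 0)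
    (f' := fun d => 2 * d * (1 - Real.exp (-(s * d ^ (-α)))))
    (fun d hd => (hasDerivAt_ringPrimitive hα hs hd).continuousAt.continuousWithinAt)
    (fun d hd => ?_) (fun d hd => ?_) <;> rw [interior_Ioi] at hd
  · exact (hasDerivAt_ringPrimitive hα hs hd).hasDerivWithinAt
  · exact two_mul_one_sub_exp_neg_nonneg α hs.le (le_of_lt hd)

lemma tendsto_sq_mul_one_sub_exp_neg (hα : 2 < α) (hs : 0 ≤ s) :
    Tendsto (fun d : ℝ => d ^ 2 * (1 - Real.exp (-(s * d ^ (-α))))) atTop (𝓝 0) := by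
  have hbound : Tendsto (fun d : ℝ => s * d ^ (-(α - 2))) atTop (𝓝 0) := by
    simpa using (tendsto_rpow_neg_atTop (sub_pos.2 hα)).const_mul s
  refine tendsto_of_tendsto_of_tendsto_of_le_of_le' tendsto_const_nhds hbound ?_ ?_
    <;> filter_upwards [eventually_gt_atTop 0] with d hd
  · exact mul_nonneg (sq_nonneg d) (one_sub_exp_neg_nonneg (by positivity))
  · calc d ^ 2 * (1 - Real.exp (-(s * d ^ (-α))))
        ≤ d ^ 2 * (s * d ^ (-α)) := by
          gcongr
          linarith [Real.one_sub_le_exp_neg (s * d ^ (-α))]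
      _ = s * d ^ (-(α - 2)) := by
          rw [neg_sub, sub_eq_add_neg, Real.rpow_add hd, Real.rpow_two]
          ring

lemma tendsto_ringPrimitive (hα : 2 < α) (hs : 0 < s) :
    Tendsto (ringPrimitive α s) atTop (𝓝 (s ^ (2 / α) * Real.Gamma (1 - 2 / α))) := by
  have hα0 : 0 < α := by linarith
  have hpow : Tendsto (fun d : ℝ => s * d ^ (-α)) atTop (𝓝[>] 0) := by
    refine tendsto_nhdsWithin_iff.2 ⟨by simpa using (tendsto_rpow_neg_atTop hα0).const_mul s, ?_⟩
    filter_upwards [eventually_gt_atTop 0] with d hd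
    exact mem_Ioi.2 (by positivity)
  have hexponent : 0 < 1 - 2 / α := sub_pos.2 ((div_lt_one hα0).2 hα)
  simpa only [zero_add] using! (tendsto_sq_mul_one_sub_exp_neg hα hs.le).add
    (((tendsto_upperGamma_zero hexponent).comp hpow).const_mul (s ^ (2 / α)))

lemma ringPrimitive_le_limit (hα : 2 < α) (hs : 0 < s) (hd : 0 < d) :
    ringPrimitive α s d ≤ s ^ (2 / α) * Real.Gamma (1 - 2 / α) := by
  refine ge_of_tendsto (tendsto_ringPrimitive hα hs) ?_
  filter_upwards [eventually_ge_atTop d] with b hb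
  exact monotoneOn_ringPrimitive (by linarith) hs hd (hd.trans_le hb) hb

lemma lintegral_Ioc_one_sub_exp_neg (hα : 0 < α) (hs : 0 < s) (ha : 0 < a) (hab : a ≤ b) :
    ∫⁻ d in Ioc a b, ENNReal.ofReal (2 * d * (1 - Real.exp (-(s * d ^ (-α)))))
      = ENNReal.ofReal (ringPrimitive α s b - ringPrimitive α s a) :=
  lintegral_Ioc_of_hasDerivAt_of_nonneg hab
    (fun _ hd => hasDerivAt_ringPrimitive hα hs (ha.trans_le hd.1))
    (fun _ hd => two_mul_one_sub_exp_neg_nonneg α hs.le (ha.trans hd.1).le)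

lemma lintegral_Ioi_one_sub_exp_neg (hα : 2 < α) (hs : 0 < s) (ha : 0 < a) :
    ∫⁻ d in Ioi a, ENNReal.ofReal (2 * d * (1 - Real.exp (-(s * d ^ (-α)))))
      = ENNReal.ofReal (s ^ (2 / α) * Real.Gamma (1 - 2 / α) - ringPrimitive α s a) :=
  lintegral_Ioi_of_hasDerivAt_of_nonneg
    (fun _ hd => hasDerivAt_ringPrimitive (by linarith) hs (ha.trans_le hd))
    (fun _ hd => two_mul_one_sub_exp_neg_nonneg α hs.le (ha.trans hd).le)
    (tendsto_ringPrimitive hα hs)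

lemma ringPrimitive_sub_le (hα : 0 < α) (hs : 0 < s) (ha : 0 < a) (hab : a ≤ b) :
    ringPrimitive α s b - ringPrimitive α s a ≤ b ^ 2 - a ^ 2 := by
  have hsq : 0 ≤ b ^ 2 - a ^ 2 := by
    rw [sub_nonneg]
    gcongr
  rw [← ENNReal.ofReal_le_ofReal_iff hsq, ← lintegral_Ioc_one_sub_exp_neg hα hs ha hab,
    ← lintegral_Ioc_two_mul ha.le hab]
  refine setLIntegral_mono (by fun_prop) fun d hd => ENNReal.ofReal_le_ofReal ?_
  exact mul_le_of_le_one_right (by linarith [hd.1]) (one_sub_exp_neg_le_one _)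

end RingPrimitive

/-! ### The averaged terms of the closed forms -/

/-- Gain of an interferer at distance `d`, in units in which the intended link has gain `1 / β`: the
factor `β d₀^α ℓ(d)` by which its fading enters the outage criterion. -/
noncomputable def relGain (q : Params) (β d : ℝ) : ℝ≥0∞ :=
  ENNReal.ofReal (β * q.d₀ ^ q.α * pathLoss q.α q.a d)

@[fun_prop]
lemma measurable_pathLoss (α a : ℝ) : Measurable (pathLoss α a) :=
  Measurable.ite measurableSet_Ici (measurable_id.pow_const _) measurable_const

lemma pathLoss_pos (α : ℝ) {a : ℝ} (ha : 0 < a) (d : ℝ) : 0 < pathLoss α a d := by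
  unfold pathLoss
  split_ifs with had
  · exact Real.rpow_pos_of_pos (ha.trans_le had) _
  · exact one_pos

@[fun_prop]
lemma measurable_relGain (q : Params) (β : ℝ) : Measurable (relGain q β) :=
  ((measurable_pathLoss q.α q.a).const_mul _).ennreal_ofReal

section Terms

variable {q : Params} {β r u d : ℝ}

lemma relGain_ne_zero (ha : 0 < q.a) (hκ : 0 < β * q.d₀ ^ q.α) (d : ℝ) : relGain q β d ≠ 0 :=
  (ENNReal.ofReal_pos.2 (mul_pos hκ (pathLoss_pos q.α ha d))).ne'

lemma one_sub_expNeg_relGain_of_lt (hκ : 0 < β * q.d₀ ^ q.α) (hu : 0 < u) (hd : d < q.a) :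
    1 - expNeg (ENNReal.ofReal u * relGain q β d)
      = ENNReal.ofReal (1 - Real.exp (-(β * q.d₀ ^ q.α * u))) := by
  rw [relGain, pathLoss, if_neg (not_le.2 hd), mul_one, ← ENNReal.ofReal_mul hu.le,
    one_sub_expNeg_ofReal (by positivity), mul_comm]

lemma ofReal_mul_one_sub_expNeg_relGain (ha : 0 < q.a) (hκ : 0 < β * q.d₀ ^ q.α) (hu : 0 < u)
    (hd : q.a ≤ d) :
    ENNReal.ofReal (2 * d) * (1 - expNeg (ENNReal.ofReal u * relGain q β d))
      = ENNReal.ofReal (2 * d * (1 - Real.exp (-(β * q.d₀ ^ q.α * u * d ^ (-q.α))))) := by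
  have hd0 : 0 < d := ha.trans_le hd
  rw [relGain, pathLoss, if_pos hd, ← ENNReal.ofReal_mul hu.le,
    one_sub_expNeg_ofReal (by positivity), ← ENNReal.ofReal_mul (by positivity)]
  ring_nf

lemma ibmTerm_eq (q : Params) (β r u : ℝ) :
    ibmTerm q β r u = q.a ^ 2 * (1 - Real.exp (-(β * q.d₀ ^ q.α * u)))
      + (ringPrimitive q.α (β * q.d₀ ^ q.α * u) r
        - ringPrimitive q.α (β * q.d₀ ^ q.α * u) q.a) := by
  unfold ibmTerm ringPrimitive
  ring

lemma prmTerm_eq (q : Params) (β r u : ℝ) :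
    prmTerm q β r u = (β * q.d₀ ^ q.α * u) ^ (2 / q.α) * Real.Gamma (1 - 2 / q.α)
        - ringPrimitive q.α (β * q.d₀ ^ q.α * u) r := by
  unfold prmTerm ringPrimitive
  ring

lemma phyTerm_eq_add_prmTerm (q : Params) (β u : ℝ) :
    phyTerm q β u = q.a ^ 2 * (1 - Real.exp (-(β * q.d₀ ^ q.α * u))) + prmTerm q β q.a u := by
  unfold phyTerm prmTerm
  ring

lemma ibmTerm_nonneg (hα : 0 < q.α) (ha : 0 < q.a) (hκ : 0 < β * q.d₀ ^ q.α) (hr : q.a ≤ r)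
    (hu : 0 < u) : 0 ≤ ibmTerm q β r u := by
  have hs := mul_pos hκ hu
  rw [ibmTerm_eq]
  exact add_nonneg (mul_nonneg (sq_nonneg _) (one_sub_exp_neg_nonneg hs.le))
    (sub_nonneg.2 (monotoneOn_ringPrimitive hα hs ha (ha.trans_le hr) hr))

lemma prmTerm_nonneg (hα : 2 < q.α) (hκ : 0 < β * q.d₀ ^ q.α) (hr : 0 < r) (hu : 0 < u) :
    0 ≤ prmTerm q β r u := by
  rw [prmTerm_eq]
  exact sub_nonneg.2 (ringPrimitive_le_limit hα (mul_pos hκ hu) hr)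

lemma phyTerm_pos (hα : 2 < q.α) (ha : 0 < q.a) (hκ : 0 < β * q.d₀ ^ q.α) (hu : 0 < u) :
    0 < phyTerm q β u := by
  rw [phyTerm_eq_add_prmTerm]
  refine add_pos_of_pos_of_nonneg (mul_pos (pow_pos ha 2) ?_) (prmTerm_nonneg hα hκ ha hu)
  simpa using mul_pos hκ hu

lemma lintegral_relGain_closedBall (hα : 0 < q.α) (ha : 0 < q.a) (hκ : 0 < β * q.d₀ ^ q.α)
    (hr : q.a ≤ r) (hu : 0 < u) :
    ∫⁻ x : Plane, (1 - expNeg (ENNReal.ofReal u * if ‖x‖ ≤ r then relGain q β ‖x‖ else 0))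
      = ENNReal.ofReal (Real.pi * ibmTerm q β r u) := by
  have hs := mul_pos hκ hu
  have hF : Measurable fun d : ℝ =>
      1 - expNeg (ENNReal.ofReal u * if d ≤ r then relGain q β d else 0) :=
    measurable_const.sub (measurable_expNeg.comp (measurable_const.mul
      (Measurable.ite measurableSet_Iic (measurable_relGain q β) measurable_const)))
  have hring : ∫⁻ d in Ioc q.a r, ENNReal.ofReal (2 * d)
      * (1 - expNeg (ENNReal.ofReal u * if d ≤ r then relGain q β d else 0))
      = ENNReal.ofReal (ringPrimitive q.α (β * q.d₀ ^ q.α * u) r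
        - ringPrimitive q.α (β * q.d₀ ^ q.α * u) q.a) := by
    rw [← lintegral_Ioc_one_sub_exp_neg hα hs ha hr]
    refine setLIntegral_congr_fun measurableSet_Ioc fun d hd => ?_
    rw [if_pos hd.2, ofReal_mul_one_sub_expNeg_relGain ha hκ hu hd.1.le]
  have hfar : ∫⁻ d in Ioi r, ENNReal.ofReal (2 * d)
      * (1 - expNeg (ENNReal.ofReal u * if d ≤ r then relGain q β d else 0)) = 0 :=
    setLIntegral_eq_zero measurableSet_Ioi fun d hd => by
      simp [not_le.2 (mem_Ioi.1 hd)]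
  rw [lintegral_plane_of_eq_on_disk hF ha.le (fun d hd => by
      rw [if_pos (hd.le.trans hr), one_sub_expNeg_relGain_of_lt hκ hu hd]),
    ← Ioc_union_Ioi_eq_Ioi hr, lintegral_union measurableSet_Ioi (Ioc_disjoint_Ioi le_rfl),
    hring, hfar, add_zero, ← ENNReal.ofReal_mul (sq_nonneg _),
    ← ENNReal.ofReal_add (mul_nonneg (sq_nonneg _) (one_sub_exp_neg_nonneg hs.le))
      (sub_nonneg.2 (monotoneOn_ringPrimitive hα hs ha (ha.trans_le hr) hr)),
    ← ENNReal.ofReal_mul Real.pi_pos.le, ibmTerm_eq]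

lemma lintegral_Ioi_relGain (hα : 2 < q.α) (ha : 0 < q.a) (hκ : 0 < β * q.d₀ ^ q.α)
    (hr : q.a ≤ r) (hu : 0 < u) :
    ∫⁻ d in Ioi r, ENNReal.ofReal (2 * d) * (1 - expNeg (ENNReal.ofReal u * relGain q β d))
      = ENNReal.ofReal (prmTerm q β r u) := by
  rw [prmTerm_eq, ← lintegral_Ioi_one_sub_exp_neg hα (mul_pos hκ hu) (ha.trans_le hr)]
  exact setLIntegral_congr_fun measurableSet_Ioi fun d hd =>
    ofReal_mul_one_sub_expNeg_relGain ha hκ hu (hr.trans (le_of_lt hd))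

lemma lintegral_relGain (hα : 2 < q.α) (ha : 0 < q.a) (hκ : 0 < β * q.d₀ ^ q.α) (hu : 0 < u) :
    ∫⁻ x : Plane, (1 - expNeg (ENNReal.ofReal u * relGain q β ‖x‖))
      = ENNReal.ofReal (Real.pi * phyTerm q β u) := by
  rw [lintegral_plane_of_eq_on_disk (F := fun d => 1 - expNeg (ENNReal.ofReal u * relGain q β d))
      (by fun_prop) ha.le (fun d hd => one_sub_expNeg_relGain_of_lt hκ hu hd),
    lintegral_Ioi_relGain hα ha hκ le_rfl hu, ← ENNReal.ofReal_mul (sq_nonneg _),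
    ← ENNReal.ofReal_add (mul_nonneg (sq_nonneg _) (one_sub_exp_neg_nonneg (mul_pos hκ hu).le))
      (prmTerm_nonneg hα hκ ha hu),
    ← ENNReal.ofReal_mul Real.pi_pos.le, phyTerm_eq_add_prmTerm]

lemma lintegral_relGain_top_on_closedBall (hα : 2 < q.α) (ha : 0 < q.a)
    (hκ : 0 < β * q.d₀ ^ q.α) (hr : q.a ≤ r) (hu : 0 < u) :
    ∫⁻ x : Plane, (1 - expNeg (ENNReal.ofReal u * if ‖x‖ ≤ r then ∞ else relGain q β ‖x‖))
      = ENNReal.ofReal (Real.pi * (r ^ 2 + prmTerm q β r u)) := by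
  have hr0 : 0 < r := ha.trans_le hr
  have hF : Measurable fun d : ℝ =>
      1 - expNeg (ENNReal.ofReal u * if d ≤ r then ∞ else relGain q β d) :=
    measurable_const.sub (measurable_expNeg.comp (measurable_const.mul
      (Measurable.ite measurableSet_Iic measurable_const (measurable_relGain q β))))
  have hfar : ∫⁻ d in Ioi r, ENNReal.ofReal (2 * d)
      * (1 - expNeg (ENNReal.ofReal u * if d ≤ r then ∞ else relGain q β d))
      = ENNReal.ofReal (prmTerm q β r u) := by
    rw [← lintegral_Ioi_relGain hα ha hκ hr hu]
    exact setLIntegral_congr_fun measurableSet_Ioi fun d hd => by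
      rw [if_neg (not_le.2 (mem_Ioi.1 hd))]
  rw [lintegral_plane_of_eq_on_disk hF hr0.le (c := 1) (fun d hd => by
      rw [if_pos hd.le, ENNReal.mul_top (ENNReal.ofReal_pos.2 hu).ne', expNeg_top, tsub_zero]),
    hfar, mul_one, ← ENNReal.ofReal_add (sq_nonneg r) (prmTerm_nonneg hα hκ hr0 hu),
    ← ENNReal.ofReal_mul Real.pi_pos.le]

lemma continuousOn_ringPrimitive_const_mul (hκ : 0 < β * q.d₀ ^ q.α) (hd : 0 < d) :
    ContinuousOn (fun u => ringPrimitive q.α (β * q.d₀ ^ q.α * u) d) (Ioi 0) :=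
  (continuousOn_ringPrimitive q.α hd).comp (by fun_prop) fun _ hu => mul_pos hκ hu

lemma continuousOn_ibmTerm (ha : 0 < q.a) (hκ : 0 < β * q.d₀ ^ q.α) (hr : 0 < r) :
    ContinuousOn (ibmTerm q β r) (Ioi 0) := by
  simp_rw [funext (ibmTerm_eq q β r)]
  exact (by fun_prop : Continuous fun u =>
      q.a ^ 2 * (1 - Real.exp (-(β * q.d₀ ^ q.α * u)))).continuousOn.add
    ((continuousOn_ringPrimitive_const_mul hκ hr).sub (continuousOn_ringPrimitive_const_mul hκ ha))

lemma continuousOn_prmTerm (hκ : 0 < β * q.d₀ ^ q.α) (hr : 0 < r) :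
    ContinuousOn (prmTerm q β r) (Ioi 0) := by
  simp_rw [funext (prmTerm_eq q β r)]
  exact ((ContinuousOn.rpow_const (by fun_prop) fun u hu => .inl (mul_pos hκ hu).ne').mul_const
    _).sub (continuousOn_ringPrimitive_const_mul hκ hr)

lemma integrable_ibmTerm (hα : 0 < q.α) (ha : 0 < q.a) (hκ : 0 < β * q.d₀ ^ q.α)
    (hr : q.a ≤ r) : Integrable (ibmTerm q β r) (expMeasure 1) := by
  refine integrable_expMeasure_of_le_add_rpow one_pos (b := r ^ 2) (c := 0) (s := 0) (by norm_num)
    (continuousOn_ibmTerm ha hκ (ha.trans_le hr)) (fun u hu => ibmTerm_nonneg hα ha hκ hr hu)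
    fun u hu => ?_
  rw [ibmTerm_eq]
  linarith [ringPrimitive_sub_le hα (mul_pos hκ hu) ha hr,
    mul_le_of_le_one_right (sq_nonneg q.a) (one_sub_exp_neg_le_one (β * q.d₀ ^ q.α * u))]

lemma integrable_prmTerm (hα : 2 < q.α) (hκ : 0 < β * q.d₀ ^ q.α) (hr : 0 < r) :
    Integrable (prmTerm q β r) (expMeasure 1) := by
  have hexponent : 0 < 2 / q.α := div_pos two_pos (by linarith)
  refine integrable_expMeasure_of_le_add_rpow one_pos (b := 0)
    (c := (β * q.d₀ ^ q.α) ^ (2 / q.α) * Real.Gamma (1 - 2 / q.α)) (s := 2 / q.α) (by linarith)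
    (continuousOn_prmTerm hκ hr) (fun u hu => prmTerm_nonneg hα hκ hr hu) fun u hu => ?_
  rw [prmTerm_eq, Real.mul_rpow hκ.le hu.le]
  linarith [ringPrimitive_nonneg q.α (mul_pos hκ hu).le hr.le]

lemma integrable_phyTerm (hα : 2 < q.α) (ha : 0 < q.a) (hκ : 0 < β * q.d₀ ^ q.α) :
    Integrable (phyTerm q β) (expMeasure 1) := by
  simp_rw [funext (phyTerm_eq_add_prmTerm q β)]
  refine Integrable.add ?_ (integrable_prmTerm hα hκ ha)
  refine integrable_expMeasure_of_le_add_rpow one_pos (b := q.a ^ 2) (c := 0) (s := 0)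
    (by norm_num) (by fun_prop) (fun u hu => ?_) fun u _ => ?_
  · exact mul_nonneg (sq_nonneg _) (one_sub_exp_neg_nonneg (mul_pos hκ hu).le)
  · simpa using mul_le_of_le_one_right (sq_nonneg q.a)
      (one_sub_exp_neg_le_one (β * q.d₀ ^ q.α * u))

lemma integral_phyTerm_pos (hα : 2 < q.α) (ha : 0 < q.a) (hκ : 0 < β * q.d₀ ^ q.α) :
    0 < ∫ u, phyTerm q β u ∂(expMeasure 1) := by
  have := isProbabilityMeasure_expMeasure one_pos
  have hpos : ∀ᵐ u ∂(expMeasure 1), 0 < phyTerm q β u := by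
    filter_upwards [ae_pos_expMeasure one_pos] with u hu using phyTerm_pos hα ha hκ hu
  have hfull : Function.support (phyTerm q β) =ᵐ[expMeasure 1] univ :=
    eventuallyEq_univ.2 (hpos.mono fun _ hu => hu.ne')
  rw [integral_pos_iff_support_of_nonneg_ae (hpos.mono fun _ hu => hu.le)
    (integrable_phyTerm hα ha hκ), measure_congr hfull, measure_univ]
  exact one_pos

end Terms

/-! ### Accuracy of one model relative to another -/

section Comparison

variable {Ω : Type*} [MeasurableSpace Ω] {P : Measure Ω} {β : ℝ} {γx γy : Ω → ℝ≥0∞}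

lemma compl_noOutage {Ω : Type*} (γ : Ω → ℝ≥0∞) (β : ℝ) : (noOutage γ β)ᶜ = outage γ β := by
  ext ω
  simp [noOutage, outage]

lemma noOutage_subset_noOutage {Ω : Type*} {γx γy : Ω → ℝ≥0∞} (hle : γy ≤ γx) (β : ℝ) :
    noOutage γy β ⊆ noOutage γx β :=
  fun ω hω => le_trans hω (hle ω)

lemma measurableSet_noOutage (hγ : Measurable γx) (β : ℝ) : MeasurableSet (noOutage γx β) :=
  measurableSet_le measurable_const hγ

lemma measurableSet_outage (hγ : Measurable γx) (β : ℝ) : MeasurableSet (outage γx β) :=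
  measurableSet_lt hγ measurable_const

lemma measureReal_noOutage [IsProbabilityMeasure P] (hγ : Measurable γx) :
    P.real (noOutage γx β) = 1 - P.real (outage γx β) := by
  rw [← compl_noOutage, probReal_compl_eq_one_sub (measurableSet_noOutage hγ β), sub_sub_cancel]

lemma measureReal_cond {s : Set Ω} (hs : MeasurableSet s) (t : Set Ω) :
    (cond P s).real t = (P.real s)⁻¹ * P.real (s ∩ t) := by
  simp [measureReal_def, cond_apply hs, ENNReal.toReal_mul, ENNReal.toReal_inv]

lemma measureReal_mul_cond [IsFiniteMeasure P] {s : Set Ω} (hs : MeasurableSet s) (t : Set Ω) :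
    P.real s * (cond P s).real t = P.real (s ∩ t) := by
  rcases eq_or_ne (P.real s) 0 with h0 | h0
  · rw [h0, zero_mul]
    exact (measureReal_mono_null inter_subset_left h0).symm
  · rw [measureReal_cond hs, mul_inv_cancel_left₀ h0]

lemma measureReal_noOutage_mul_falseAlarm [IsFiniteMeasure P] (hy : Measurable γy) :
    P.real (noOutage γy β) * falseAlarm P β γx γy = P.real (noOutage γy β ∩ outage γx β) :=
  measureReal_mul_cond (measurableSet_noOutage hy β) _

lemma measureReal_outage_mul_missDetection [IsFiniteMeasure P] (hy : Measurable γy) :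
    P.real (outage γy β) * missDetection P β γx γy = P.real (outage γy β ∩ noOutage γx β) :=
  measureReal_mul_cond (measurableSet_outage hy β) _

lemma measureReal_noOutage_inter_noOutage [IsFiniteMeasure P] (hx : Measurable γx)
    (hy : Measurable γy) :
    P.real (noOutage γy β ∩ noOutage γx β)
      = P.real (noOutage γy β) * (1 - falseAlarm P β γx γy) := by
  rw [mul_one_sub, measureReal_noOutage_mul_falseAlarm hy,
    ← measureReal_inter_add_sdiff (s := noOutage γy β) (measurableSet_noOutage hx β),
    Set.sdiff_eq, compl_noOutage, add_sub_cancel_right]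

lemma falseAlarm_of_le (hy : Measurable γy) (hle : γy ≤ γx) : falseAlarm P β γx γy = 0 := by
  have hempty : noOutage γy β ∩ outage γx β = ∅ := by
    rw [← compl_noOutage, ← Set.sdiff_eq, sdiff_eq_empty]
    exact noOutage_subset_noOutage hle β
  rw [falseAlarm, measureReal_cond (measurableSet_noOutage hy β), hempty, measureReal_empty,
    mul_zero]

lemma measureReal_outage_inter_noOutage_of_le [IsProbabilityMeasure P] (hx : Measurable γx)
    (hy : Measurable γy) (hle : γy ≤ γx) :
    P.real (outage γy β ∩ noOutage γx β) = P.real (outage γy β) - P.real (outage γx β) := by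
  rw [inter_comm, ← compl_noOutage γy, ← Set.sdiff_eq, compl_noOutage,
    measureReal_sdiff (noOutage_subset_noOutage hle β) (measurableSet_noOutage hy β),
    measureReal_noOutage hx, measureReal_noOutage hy]
  ring

lemma missDetection_of_le [IsProbabilityMeasure P] (hx : Measurable γx) (hy : Measurable γy)
    (hle : γy ≤ γx) (hpos : P.real (outage γy β) ≠ 0) :
    missDetection P β γx γy = 1 - P.real (outage γx β) / P.real (outage γy β) := by
  rw [missDetection, measureReal_cond (measurableSet_outage hy β),
    measureReal_outage_inter_noOutage_of_le hx hy hle]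
  field_simp

/-- Bayes' rule: exchanging test and reference model conditions on `γx` instead of `γy`. -/
lemma falseAlarm_eq_one_sub_div [IsProbabilityMeasure P] (hx : Measurable γx)
    (hy : Measurable γy) (hlt : P.real (outage γy β) < 1) :
    falseAlarm P β γx γy
      = 1 - (1 - P.real (outage γx β)) * (1 - falseAlarm P β γy γx)
          / (1 - P.real (outage γy β)) := by
  have hpos : P.real (noOutage γy β) ≠ 0 := by
    rw [measureReal_noOutage hy]
    exact (sub_pos.2 hlt).ne'
  rw [← measureReal_noOutage hx, ← measureReal_noOutage hy,
    ← measureReal_noOutage_inter_noOutage hy hx, inter_comm,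
    measureReal_noOutage_inter_noOutage hx hy, mul_div_cancel_left₀ _ hpos, sub_sub_cancel]

lemma missDetection_eq_div [IsProbabilityMeasure P] (hx : Measurable γx) (hy : Measurable γy) :
    missDetection P β γx γy
      = (1 - P.real (outage γx β)) * falseAlarm P β γy γx / P.real (outage γy β) := by
  rw [← measureReal_noOutage hx, measureReal_noOutage_mul_falseAlarm hx, missDetection,
    measureReal_cond (measurableSet_outage hy β), inter_comm, inv_mul_eq_div]

/-- With the weight `ξ = P[γy ≥ β]` the index is the probability that both models agree. -/
lemma similarityIndex_measureReal_noOutage [IsProbabilityMeasure P] (hy : Measurable γy) :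
    similarityIndex P β (P.real (noOutage γy β)) γx γy
      = 1 - P.real (noOutage γy β ∩ outage γx β) - P.real (outage γy β ∩ noOutage γx β) := by
  have hcompl : 1 - P.real (noOutage γy β) = P.real (outage γy β) := by
    rw [measureReal_noOutage hy, sub_sub_cancel]
  rw [similarityIndex, hcompl, mul_one_sub, mul_one_sub, measureReal_noOutage_mul_falseAlarm hy,
    measureReal_outage_mul_missDetection hy, ← hcompl]
  ring

lemma similarityIndex_measureReal_noOutage_of_le [IsProbabilityMeasure P] (hx : Measurable γx)
    (hy : Measurable γy) (hle : γy ≤ γx) :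
    similarityIndex P β (P.real (noOutage γy β)) γx γy
      = 1 - (P.real (outage γy β) - P.real (outage γx β)) := by
  rw [similarityIndex_measureReal_noOutage hy, measureReal_outage_inter_noOutage_of_le hx hy hle,
    ← measureReal_noOutage_mul_falseAlarm hy, falseAlarm_of_le hy hle, mul_zero, sub_zero]

lemma similarityIndex_measureReal_noOutage_eq [IsProbabilityMeasure P] (hx : Measurable γx)
    (hy : Measurable γy) :
    similarityIndex P β (P.real (noOutage γy β)) γx γy
      = P.real (outage γy β) + (1 - P.real (outage γx β)) * (1 - 2 * falseAlarm P β γy γx) := by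
  have hagree := measureReal_noOutage_inter_noOutage (P := P) (β := β) hy hx
  rw [inter_comm, measureReal_noOutage_inter_noOutage hx hy, mul_one_sub,
    measureReal_noOutage_mul_falseAlarm hy] at hagree
  rw [similarityIndex_measureReal_noOutage hy, inter_comm (outage γy β),
    ← measureReal_noOutage_mul_falseAlarm hx, ← measureReal_noOutage hx]
  rw [measureReal_noOutage hy] at hagree
  linarith

end Comparison

/-! ### Outage as a coverage event -/

section Outage

variable {q : Params} {β : ℝ}

lemma ofReal_mul_channelGain_link (hp : 0 < q.p) (hc : 0 < q.c) (hd : 0 < q.d₀)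
    (hd₀ : q.a ≤ q.d₀) (u : ℝ) :
    ENNReal.ofReal (q.d₀ ^ q.α / (q.p * q.c)) * ENNReal.ofReal (q.p * channelGain q u q.d₀)
      = ENNReal.ofReal u := by
  rw [← ENNReal.ofReal_mul (by positivity), channelGain, pathLoss, if_pos hd₀,
    Real.rpow_neg hd.le]
  congr 1
  field_simp

lemma ofReal_mul_channelGain_interferer (hp : 0 < q.p) (hc : 0 < q.c) (ha : 0 < q.a)
    (hd : 0 < q.d₀) (hβ : 0 < β) (v : ℝ≥0∞) (u d : ℝ) :
    ENNReal.ofReal (q.d₀ ^ q.α / (q.p * q.c))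
        * (ENNReal.ofReal β * (ENNReal.ofReal q.p * (v * ENNReal.ofReal (channelGain q u d))))
      = ENNReal.ofReal u * (v * relGain q β d) := by
  have hconst : ENNReal.ofReal (q.d₀ ^ q.α / (q.p * q.c)) * ENNReal.ofReal β
      * ENNReal.ofReal q.p * ENNReal.ofReal q.c = ENNReal.ofReal (β * q.d₀ ^ q.α) := by
    rw [← ENNReal.ofReal_mul (by positivity), ← ENNReal.ofReal_mul (by positivity),
      ← ENNReal.ofReal_mul (by positivity)]
    congr 1
    field_simp
  rw [relGain, channelGain, ENNReal.ofReal_mul (p := β * q.d₀ ^ q.α) (by positivity), ← hconst,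
    ENNReal.ofReal_mul' (pathLoss_pos q.α ha d).le, ENNReal.ofReal_mul hc.le]
  ring

lemma le_sinr_iff (hp : 0 < q.p) (hc : 0 < q.c) (ha : 0 < q.a) (hd₀ : q.a ≤ q.d₀) (hβ : 0 < β)
    (noise : ℝ) (v : Plane → ℝ≥0∞) (x : ℕ → Plane) {u : ℝ} (hu : 0 < u) (h : ℕ → ℝ) :
    ENNReal.ofReal β ≤ sinr q noise (fun k => v (x k)) x u h ↔
      ENNReal.ofReal (noise * β * q.d₀ ^ q.α / (q.p * q.c))
        + interference (fun y => v y * relGain q β ‖y‖) x h ≤ ENNReal.ofReal u := by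
  have hd : 0 < q.d₀ := ha.trans_le hd₀
  have hscale : 0 < q.d₀ ^ q.α / (q.p * q.c) := by positivity
  have hlink : 0 < q.p * channelGain q u q.d₀ :=
    mul_pos hp (mul_pos (mul_pos hc hu) (pathLoss_pos q.α ha q.d₀))
  have hnoise : ENNReal.ofReal (q.d₀ ^ q.α / (q.p * q.c))
      * (ENNReal.ofReal β * ENNReal.ofReal noise)
      = ENNReal.ofReal (noise * β * q.d₀ ^ q.α / (q.p * q.c)) := by
    rw [← ENNReal.ofReal_mul hβ.le, ← ENNReal.ofReal_mul hscale.le]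
    congr 1
    field_simp
  rw [sinr, ENNReal.le_div_iff_mul_le (.inr (ENNReal.ofReal_pos.2 hlink).ne')
      (.inr ENNReal.ofReal_ne_top),
    ← ENNReal.mul_le_mul_iff_right (ENNReal.ofReal_pos.2 hscale).ne' ENNReal.ofReal_ne_top,
    ofReal_mul_channelGain_link hp hc hd hd₀, mul_add, mul_add, hnoise,
    ← ENNReal.tsum_mul_left, ← ENNReal.tsum_mul_left, add_comm]
  simp_rw [ofReal_mul_channelGain_interferer hp hc ha hd hβ]
  rfl

lemma sinrPhyM_le_sinrIBM {Ω : Type*} (q : Params) (r : ℝ) (X : ℕ → Ω → Plane) (h₀ : Ω → ℝ)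
    (h : ℕ → Ω → ℝ) : sinrPhyM q X h₀ h ≤ sinrIBM q r X h₀ h := fun ω => by
  refine ENNReal.div_le_div_left (add_le_add_left (ENNReal.tsum_le_tsum fun k => ?_) _) _
  have hweight : (if ‖X k ω‖ ≤ r then 1 else 0 : ℝ≥0∞) ≤ 1 := by split_ifs <;> simp
  gcongr

end Outage

namespace IsRayleighPoissonNetwork

variable {Ω : Type*} [MeasurableSpace Ω] {P : Measure Ω} {q : Params} {lam β r : ℝ}
  {X : ℕ → Ω → Plane} {h₀ : Ω → ℝ} {h : ℕ → Ω → ℝ}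

lemma measurable_sinr (hnet : IsRayleighPoissonNetwork P lam X h₀ h) (q : Params) (noise : ℝ)
    {v : Plane → ℝ≥0∞} (hv : Measurable v) :
    Measurable fun ω =>
      sinr q noise (fun k => v (X k ω)) (fun k => X k ω) (h₀ ω) (fun k => h k ω) := by
  have hX := hnet.poisson.measurable
  have hh := hnet.measurable_h
  have hh₀ := hnet.measurable_h₀
  unfold sinr channelGain
  fun_prop

lemma measurable_sinrPhyM (hnet : IsRayleighPoissonNetwork P lam X h₀ h) (q : Params) :
    Measurable (sinrPhyM q X h₀ h) :=
  hnet.measurable_sinr q q.σ (v := fun _ => 1) measurable_const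

lemma measurable_sinrIBM (hnet : IsRayleighPoissonNetwork P lam X h₀ h) (q : Params) (r : ℝ) :
    Measurable (sinrIBM q r X h₀ h) :=
  hnet.measurable_sinr q q.σ (v := fun y => if ‖y‖ ≤ r then 1 else 0)
    (Measurable.ite (measurableSet_le measurable_norm measurable_const) measurable_const
      measurable_const)

lemma measurable_sinrPRM (hnet : IsRayleighPoissonNetwork P lam X h₀ h) (q : Params) (r : ℝ) :
    Measurable (sinrPRM q r X h₀ h) :=
  hnet.measurable_sinr q 0 (v := fun y => if ‖y‖ ≤ r then ∞ else 0)
    (Measurable.ite (measurableSet_le measurable_norm measurable_const) measurable_const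
      measurable_const)

lemma ae_le_sinrPhyM_iff (hnet : IsRayleighPoissonNetwork P lam X h₀ h) (hp : 0 < q.p)
    (hc : 0 < q.c) (ha : 0 < q.a) (hd₀ : q.a ≤ q.d₀) (hβ : 0 < β) :
    ∀ᵐ ω ∂P, ENNReal.ofReal β ≤ sinrPhyM q X h₀ h ω ↔
      ENNReal.ofReal (q.σ * β * q.d₀ ^ q.α / (q.p * q.c))
        + interference (fun y => relGain q β ‖y‖) (fun k => X k ω) (fun k => h k ω)
        ≤ ENNReal.ofReal (h₀ ω) := by
  filter_upwards [hnet.ae_pos_h₀] with ω hω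
  rw [sinrPhyM, le_sinr_iff hp hc ha hd₀ hβ q.σ (fun _ => 1) _ hω]
  simp only [one_mul]

lemma ae_le_sinrIBM_iff (hnet : IsRayleighPoissonNetwork P lam X h₀ h) (hp : 0 < q.p)
    (hc : 0 < q.c) (ha : 0 < q.a) (hd₀ : q.a ≤ q.d₀) (hβ : 0 < β) (r : ℝ) :
    ∀ᵐ ω ∂P, ENNReal.ofReal β ≤ sinrIBM q r X h₀ h ω ↔
      ENNReal.ofReal (q.σ * β * q.d₀ ^ q.α / (q.p * q.c))
        + interference (fun y => if ‖y‖ ≤ r then relGain q β ‖y‖ else 0) (fun k => X k ω)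
          (fun k => h k ω) ≤ ENNReal.ofReal (h₀ ω) := by
  filter_upwards [hnet.ae_pos_h₀] with ω hω
  rw [sinrIBM, le_sinr_iff hp hc ha hd₀ hβ q.σ (fun y => if ‖y‖ ≤ r then 1 else 0) _ hω]
  simp only [ite_mul, one_mul, zero_mul]

lemma ae_le_sinrPRM_iff (hnet : IsRayleighPoissonNetwork P lam X h₀ h) (hp : 0 < q.p)
    (hc : 0 < q.c) (ha : 0 < q.a) (hd₀ : q.a ≤ q.d₀) (hβ : 0 < β) (r : ℝ) :
    ∀ᵐ ω ∂P, ENNReal.ofReal β ≤ sinrPRM q r X h₀ h ω ↔ ∀ k, ¬ ‖X k ω‖ ≤ r := by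
  have hκ : 0 < β * q.d₀ ^ q.α := mul_pos hβ (Real.rpow_pos_of_pos (ha.trans_le hd₀) _)
  filter_upwards [hnet.ae_pos_h₀, hnet.ae_pos_h] with ω hω hpos
  rw [sinrPRM, le_sinr_iff hp hc ha hd₀ hβ 0 (fun y => if ‖y‖ ≤ r then ∞ else 0) _ hω]
  simp only [ite_mul, ENNReal.top_mul (relGain_ne_zero ha hκ _), zero_mul]
  rw [add_interference_ite_top_le_iff (fun y : Plane => ‖y‖ ≤ r) (fun _ => 0) _ hpos _
    ENNReal.ofReal_ne_top]
  simp [interference]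

lemma ae_sinrPRM_lt_iff (hnet : IsRayleighPoissonNetwork P lam X h₀ h) (hp : 0 < q.p)
    (hc : 0 < q.c) (ha : 0 < q.a) (hd₀ : q.a ≤ q.d₀) (hβ : 0 < β) (r : ℝ) :
    ∀ᵐ ω ∂P, sinrPRM q r X h₀ h ω < ENNReal.ofReal β ↔ ∃ k, ‖X k ω‖ ≤ r := by
  filter_upwards [hnet.ae_le_sinrPRM_iff hp hc ha hd₀ hβ r] with ω hω
  rw [← not_le, hω, not_forall_not]

lemma measureReal_forall_lt_norm (hnet : IsRayleighPoissonNetwork P lam X h₀ h)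
    (hlam : 0 ≤ lam) (hr : 0 ≤ r) :
    P.real {ω | ∀ k, ¬ ‖X k ω‖ ≤ r} = Real.exp (-(lam * Real.pi * r ^ 2)) := by
  have hvol : (ENNReal.ofReal lam • (volume : Measure Plane)) (Metric.closedBall 0 r)
      = ENNReal.ofReal (lam * Real.pi * r ^ 2) := by
    rw [Measure.smul_apply, EuclideanSpace.volume_closedBall_fin_two, smul_eq_mul,
      ← ENNReal.ofReal_pow hr, ← ENNReal.ofReal_mul (by positivity), ← ENNReal.ofReal_mul hlam]
    ring_nf
  have hvoid := hnet.poisson.measureReal_forall_notMem measurableSet_closedBall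
    (hvol.trans_ne ENNReal.ofReal_ne_top)
  simp only [mem_closedBall_zero_iff] at hvoid
  rw [hvoid, measureReal_def, hvol, ENNReal.toReal_ofReal (by positivity)]

/-! ### Outage probabilities -/

lemma measureReal_outage_sinrIBM (hnet : IsRayleighPoissonNetwork P lam X h₀ h)
    (hlam : 0 ≤ lam) (hp : 0 < q.p) (hc : 0 < q.c) (hα : 0 < q.α) (ha : 0 < q.a) (hσ : 0 ≤ q.σ)
    (hd₀ : q.a ≤ q.d₀) (hβ : 0 < β) (hr : q.a ≤ r) :
    P.real (outage (sinrIBM q r X h₀ h) β) = ibmOutage q lam β r := by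
  have hd : 0 < q.d₀ := ha.trans_le hd₀
  have hκ : 0 < β * q.d₀ ^ q.α := by positivity
  have hg : Measurable fun y : Plane => if ‖y‖ ≤ r then relGain q β ‖y‖ else 0 :=
    Measurable.ite (measurableSet_le measurable_norm measurable_const) (by fun_prop)
      measurable_const
  have := hnet.poisson.isProbabilityMeasure
  rw [← sub_right_inj (a := 1), ← measureReal_noOutage (hnet.measurable_sinrIBM q r),
    ibmOutage, closedForm, sub_sub_cancel, neg_div,
    ← hnet.measureReal_coverage hlam hg (integrable_ibmTerm hα ha hκ hr)
      (fun _ => ibmTerm_nonneg hα ha hκ hr) (fun _ => lintegral_relGain_closedBall hα ha hκ hr)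
      (by positivity)]
  exact measureReal_congr (eventuallyEq_set.2 (hnet.ae_le_sinrIBM_iff hp hc ha hd₀ hβ r))

lemma measureReal_outage_sinrPhyM (hnet : IsRayleighPoissonNetwork P lam X h₀ h)
    (hlam : 0 ≤ lam) (hp : 0 < q.p) (hc : 0 < q.c) (hα : 2 < q.α) (ha : 0 < q.a) (hσ : 0 ≤ q.σ)
    (hd₀ : q.a ≤ q.d₀) (hβ : 0 < β) :
    P.real (outage (sinrPhyM q X h₀ h) β) = phyOutage q lam β := by
  have hd : 0 < q.d₀ := ha.trans_le hd₀
  have hκ : 0 < β * q.d₀ ^ q.α := by positivity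
  have := hnet.poisson.isProbabilityMeasure
  rw [← sub_right_inj (a := 1), ← measureReal_noOutage (hnet.measurable_sinrPhyM q),
    phyOutage, closedForm, sub_sub_cancel, neg_div,
    ← hnet.measureReal_coverage hlam (g := fun y => relGain q β ‖y‖) (by fun_prop)
      (integrable_phyTerm hα ha hκ) (fun _ hu => (phyTerm_pos hα ha hκ hu).le)
      (fun _ => lintegral_relGain hα ha hκ) (by positivity)]
  exact measureReal_congr (eventuallyEq_set.2 (hnet.ae_le_sinrPhyM_iff hp hc ha hd₀ hβ))

lemma measureReal_outage_sinrPRM (hnet : IsRayleighPoissonNetwork P lam X h₀ h)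
    (hlam : 0 ≤ lam) (hp : 0 < q.p) (hc : 0 < q.c) (ha : 0 < q.a) (hd₀ : q.a ≤ q.d₀)
    (hβ : 0 < β) (hr : 0 ≤ r) :
    P.real (outage (sinrPRM q r X h₀ h) β) = prmOutage lam r := by
  have := hnet.poisson.isProbabilityMeasure
  rw [← sub_right_inj (a := 1), ← measureReal_noOutage (hnet.measurable_sinrPRM q r),
    prmOutage, sub_sub_cancel, ← hnet.measureReal_forall_lt_norm hlam hr]
  exact measureReal_congr (eventuallyEq_set.2 (hnet.ae_le_sinrPRM_iff hp hc ha hd₀ hβ r))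

/-- No outage in either model is coverage in the physical model with gain `∞` at distance at
most `r`, so that the joint probability is again a Laplace functional. -/
lemma ae_mem_noOutage_sinrPRM_inter_iff (hnet : IsRayleighPoissonNetwork P lam X h₀ h)
    (hp : 0 < q.p) (hc : 0 < q.c) (ha : 0 < q.a) (hd₀ : q.a ≤ q.d₀) (hβ : 0 < β) (r : ℝ) :
    ∀ᵐ ω ∂P, ω ∈ noOutage (sinrPRM q r X h₀ h) β ∩ noOutage (sinrPhyM q X h₀ h) β ↔
      ENNReal.ofReal (q.σ * β * q.d₀ ^ q.α / (q.p * q.c))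
        + interference (fun y => if ‖y‖ ≤ r then ∞ else relGain q β ‖y‖) (fun k => X k ω)
          (fun k => h k ω) ≤ ENNReal.ofReal (h₀ ω) := by
  filter_upwards [hnet.ae_le_sinrPRM_iff hp hc ha hd₀ hβ r,
    hnet.ae_le_sinrPhyM_iff hp hc ha hd₀ hβ, hnet.ae_pos_h] with ω hprm hphy hpos
  rw [add_interference_ite_top_le_iff (fun y : Plane => ‖y‖ ≤ r) (fun y => relGain q β ‖y‖) _
    hpos _ ENNReal.ofReal_ne_top, ← hprm, ← hphy]
  rfl

lemma measureReal_noOutage_sinrPRM_inter (hnet : IsRayleighPoissonNetwork P lam X h₀ h)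
    (hlam : 0 ≤ lam) (hp : 0 < q.p) (hc : 0 < q.c) (hα : 2 < q.α) (ha : 0 < q.a) (hσ : 0 ≤ q.σ)
    (hd₀ : q.a ≤ q.d₀) (hβ : 0 < β) (hr : q.a ≤ r) :
    P.real (noOutage (sinrPRM q r X h₀ h) β ∩ noOutage (sinrPhyM q X h₀ h) β)
      = (1 - prmOutage lam r) * (1 - phyOutageGivenPRM q lam β r) := by
  have hd : 0 < q.d₀ := ha.trans_le hd₀
  have hr0 : 0 < r := ha.trans_le hr
  have hκ : 0 < β * q.d₀ ^ q.α := by positivity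
  have := isProbabilityMeasure_expMeasure one_pos
  have hg : Measurable fun y : Plane => if ‖y‖ ≤ r then ∞ else relGain q β ‖y‖ :=
    Measurable.ite (measurableSet_le measurable_norm measurable_const) measurable_const
      (by fun_prop)
  have hQ := integrable_prmTerm hα hκ hr0
  rw [measureReal_congr (eventuallyEq_set.2
      (hnet.ae_mem_noOutage_sinrPRM_inter_iff hp hc ha hd₀ hβ r))]
  refine (hnet.measureReal_coverage hlam hg ((integrable_const (r ^ 2)).add hQ)
    (fun _ hu => add_nonneg (sq_nonneg r) (prmTerm_nonneg hα hκ hr0 hu))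
    (fun _ => lintegral_relGain_top_on_closedBall hα ha hκ hr) (by positivity)).trans ?_
  simp only [Pi.add_apply]
  rw [integral_add (integrable_const _) hQ, integral_const, probReal_univ, one_smul, prmOutage,
    phyOutageGivenPRM, closedForm, sub_sub_cancel, sub_sub_cancel, ← Real.exp_add]
  ring_nf

lemma falseAlarm_sinrPhyM_sinrPRM (hnet : IsRayleighPoissonNetwork P lam X h₀ h)
    (hlam : 0 ≤ lam) (hp : 0 < q.p) (hc : 0 < q.c) (hα : 2 < q.α) (ha : 0 < q.a) (hσ : 0 ≤ q.σ)
    (hd₀ : q.a ≤ q.d₀) (hβ : 0 < β) (hr : q.a ≤ r) :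
    falseAlarm P β (sinrPhyM q X h₀ h) (sinrPRM q r X h₀ h) = phyOutageGivenPRM q lam β r := by
  have := hnet.poisson.isProbabilityMeasure
  have hinter := hnet.measureReal_noOutage_sinrPRM_inter hlam hp hc hα ha hσ hd₀ hβ hr
  have hpos : 1 - prmOutage lam r ≠ 0 := by
    rw [prmOutage, sub_sub_cancel]
    exact Real.exp_ne_zero _
  rw [measureReal_noOutage_inter_noOutage (hnet.measurable_sinrPhyM q)
    (hnet.measurable_sinrPRM q r),
    measureReal_noOutage (hnet.measurable_sinrPRM q r),
    hnet.measureReal_outage_sinrPRM hlam hp hc ha hd₀ hβ (ha.le.trans hr)] at hinter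
  linarith [mul_left_cancel₀ hpos hinter]

end IsRayleighPoissonNetwork

lemma closedForm_lt_one (q : Params) (lam β : ℝ) (F : ℝ → ℝ) : closedForm q lam β F < 1 :=
  sub_lt_self 1 (Real.exp_pos _)

lemma phyOutage_pos {q : Params} {lam β : ℝ} (hlam : 0 < lam) (hp : 0 < q.p) (hc : 0 < q.c)
    (hα : 2 < q.α) (ha : 0 < q.a) (hσ : 0 ≤ q.σ) (hd₀ : q.a ≤ q.d₀) (hβ : 0 < β) :
    0 < phyOutage q lam β := by
  have hd : 0 < q.d₀ := ha.trans_le hd₀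
  have hmean := integral_phyTerm_pos hα ha (by positivity : 0 < β * q.d₀ ^ q.α)
  have hnoise : 0 ≤ q.σ * β * q.d₀ ^ q.α / (q.p * q.c) := by positivity
  have hintensity : 0 < Real.pi * lam * ∫ u, phyTerm q β u ∂(expMeasure 1) := by positivity
  rw [phyOutage, closedForm, sub_pos, Real.exp_lt_one_iff, neg_div]
  linarith

end OutageModel

open OutageModel in
theorem mainTheorem3 {Ω : Type*} [MeasurableSpace Ω] (P : Measure Ω) [IsProbabilityMeasure P]
    (q : Params) (hp : 0 < q.p) (hc : 0 < q.c) (hα : 0 < q.α) (ha : 0 < q.a) (hσ : 0 ≤ q.σ)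
    (hd₀ : q.a ≤ q.d₀)
    (lam : ℝ) (hlam : 0 < lam) (β : ℝ) (hβ : 0 < β)
    (rIBM : ℝ) (hrIBM : q.a ≤ rIBM) (rPRM : ℝ) (hrPRM : q.a ≤ rPRM)
    (X : ℕ → Ω → Plane) (h₀ : Ω → ℝ) (h : ℕ → Ω → ℝ)
    (hnet : IsRayleighPoissonNetwork P lam X h₀ h)
    (γPhyM γIBM γPRM : Ω → ℝ≥0∞)
    (hPhyM : γPhyM = sinrPhyM q X h₀ h)
    (hIBM : γIBM = sinrIBM q rIBM X h₀ h)
    (hPRM : γPRM = sinrPRM q rPRM X h₀ h) :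
    -- interference ball model
    (Integrable (ibmTerm q β rIBM) (expMeasure 1) ∧
      P.real (outage γIBM β) = ibmOutage q lam β rIBM) ∧
    -- protocol model
    ((∀ᵐ ω ∂P, γPRM ω < ENNReal.ofReal β ↔ ∃ k, ‖X k ω‖ ≤ rPRM) ∧
      P.real (outage γPRM β) = prmOutage lam rPRM) ∧
    (2 < q.α →
      -- physical model
      (Integrable (phyTerm q β) (expMeasure 1) ∧
        P.real (outage γPhyM β) = phyOutage q lam β ∧
        0 < phyOutage q lam β ∧ phyOutage q lam β < 1) ∧
      -- physical model given no outage under the protocol model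
      (Integrable (prmTerm q β rPRM) (expMeasure 1) ∧
        (cond P (noOutage γPRM β)).real (outage γPhyM β) = phyOutageGivenPRM q lam β rPRM) ∧
      -- accuracy index of the interference ball model
      (falseAlarm P β γIBM γPhyM = 0 ∧
        missDetection P β γIBM γPhyM = 1 - ibmOutage q lam β rIBM / phyOutage q lam β ∧
        (∀ ξ ∈ Icc (0 : ℝ) 1, similarityIndex P β ξ γIBM γPhyM
          = 1 - (1 - ξ) * (1 - ibmOutage q lam β rIBM / phyOutage q lam β)) ∧
        similarityIndex P β (P.real (noOutage γPhyM β)) γIBM γPhyM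
          = 1 - (phyOutage q lam β - ibmOutage q lam β rIBM)) ∧
      -- accuracy index of the protocol model
      (falseAlarm P β γPRM γPhyM
          = 1 - (1 - prmOutage lam rPRM) * (1 - phyOutageGivenPRM q lam β rPRM)
              / (1 - phyOutage q lam β) ∧
        missDetection P β γPRM γPhyM
          = (1 - prmOutage lam rPRM) * phyOutageGivenPRM q lam β rPRM / phyOutage q lam β ∧
        (∀ ξ ∈ Icc (0 : ℝ) 1, similarityIndex P β ξ γPRM γPhyM
          = 1 - ξ * (1 - (1 - prmOutage lam rPRM) * (1 - phyOutageGivenPRM q lam β rPRM)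
                / (1 - phyOutage q lam β))
              - (1 - ξ) * ((1 - prmOutage lam rPRM) * phyOutageGivenPRM q lam β rPRM
                / phyOutage q lam β)) ∧
        similarityIndex P β (P.real (noOutage γPhyM β)) γPRM γPhyM
          = phyOutage q lam β
              + (1 - prmOutage lam rPRM) * (1 - 2 * phyOutageGivenPRM q lam β rPRM))) := by
  subst hPhyM hIBM hPRM
  have hκ : 0 < β * q.d₀ ^ q.α := mul_pos hβ (Real.rpow_pos_of_pos (ha.trans_le hd₀) _)
  have hPhyM := hnet.measurable_sinrPhyM q
  have hIBM := hnet.measurable_sinrIBM q rIBM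
  have hPRM := hnet.measurable_sinrPRM q rPRM
  have hle := sinrPhyM_le_sinrIBM q rIBM X h₀ h
  have hI := hnet.measureReal_outage_sinrIBM hlam.le hp hc hα ha hσ hd₀ hβ hrIBM
  have hR := hnet.measureReal_outage_sinrPRM hlam.le hp hc ha hd₀ hβ (ha.le.trans hrPRM)
  refine ⟨⟨integrable_ibmTerm hα ha hκ hrIBM, hI⟩,
    ⟨hnet.ae_sinrPRM_lt_iff hp hc ha hd₀ hβ rPRM, hR⟩, fun hα2 => ?_⟩
  have hA := hnet.measureReal_outage_sinrPhyM hlam.le hp hc hα2 ha hσ hd₀ hβ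
  have hQ := hnet.falseAlarm_sinrPhyM_sinrPRM hlam.le hp hc hα2 ha hσ hd₀ hβ hrPRM
  have hpos := phyOutage_pos hlam hp hc hα2 ha hσ hd₀ hβ
  have hlt : phyOutage q lam β < 1 := closedForm_lt_one q lam β (phyTerm q β)
  have hfaI := falseAlarm_of_le (P := P) (β := β) hPhyM hle
  have hmdI := missDetection_of_le hIBM hPhyM hle (hA.trans_ne hpos.ne')
  have hfaR := falseAlarm_eq_one_sub_div hPRM hPhyM (hA.trans_lt hlt)
  have hmdR := missDetection_eq_div (P := P) (β := β) hPRM hPhyM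
  rw [hI, hA] at hmdI
  rw [hR, hQ, hA] at hfaR hmdR
  refine ⟨⟨integrable_phyTerm hα2 ha hκ, hA, hpos, hlt⟩,
    ⟨integrable_prmTerm hα2 hκ (ha.trans_le hrPRM), hQ⟩,
    ⟨hfaI, hmdI, fun ξ _ => by rw [similarityIndex, hfaI, hmdI]; ring, ?_⟩,
    ⟨hfaR, hmdR, fun ξ _ => by rw [similarityIndex, hfaR, hmdR]; ring, ?_⟩⟩
  · rw [similarityIndex_measureReal_noOutage_of_le hIBM hPhyM hle, hI, hA]
  · rw [similarityIndex_measureReal_noOutage_eq hPRM hPhyM, hR, hQ, hA]
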